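/- Let $D\ge 0$ be an even integer and let $Q_D$ be the hypercube with vertex set $\mathcal X=\{0,1\}^D$, two vertices being adjacent when they differ in exactly one coordinate. Let $\partial$ be its distance function and fix a vertex $\mathbf x$. Let $\mathbf A\in\mathrm{Mat}_{\mathcal X}(\mathbb C)$ be the adjacency matrix; it acts on the standard module $V=\mathbb C^{\mathcal X}$. Its distinct eigenvalues are $\theta_i=(-1)^i(D-2i)$ for $0\le i\le D$, with primitive idempotents $\mathbf F_i=\prod_{0\le j\le D,\,j\ne i}\frac{\mathbf A-\theta_j\mathbf I}{\theta_i-\theta_j}$ (and $\mathbf F_i=0$ for $i>D$). Let $\mathbf B$ be the dual adjacency matrix with respect to $\mathbf x$ and this ordering of the eigenvalues, that is, the diagonal matrix with $\mathbf B_{\mathbf y\mathbf y}=|\mathcal X|\,(\mathbf F_1)_{\mathbf x\mathbf y}$. Let $T$ be the Terwilliger algebra of $Q_D$ with respect to $\mathbf x$: the subalgebra of $\mathrm{Mat}_{\mathcal X}(\mathbb C)$ generated by $\mathbf A$ and the diagonal matrices $\mathbf E_i^*$ ($0\le i\le D$), where $(\mathbf E_i^*)_{\mathbf y\mathbf y}$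 is $1$ if $\partial(\mathbf x,\mathbf y)=i$ and $0$ otherwise. An irreducible $T$-module is a nonzero $T$-stable subspace of $V$ whose only $T$-stable subspaces are $0$ and itself. Let $\mathcal A$ be the unital associative $\mathbb C$-algebra with generators $x,y,z$ and relations $xy+yx=2z$, $yz+zy=2x$, $zx+xz=2y$. A Leonard triple on a vector space $W$ of finite positive dimension is an ordered triple of endomorphisms of $W$ such that, for each of the three, some basis of $W$ makes it diagonal and makes the other two irreducible tridiagonal (tridiagonal with all sub- and superdiagonal entries nonzero). It is totally bipartite if all the tridiagonal matrices arising in this way have zero diagonal. It is of Bannai/Ito type if, for every basis $v_0,\dots,v_d$ of $W$ in which the first map is diagonal, with $v_i$ having eigenvalue $\vartheta_i$, and the other two are irreducible tridiagonal, $(\vartheta_{i-2}-\vartheta_{i+1})/(\vartheta_{i-1}-\vartheta_i)=-1$ for $2\le i\le d-1$. **Theorem.** There is a unique $\mathcal A$-module structure on $V$ in which $x,y$ act as $\mathbf A,\mathbf B$. Let $\mathbf C\in\mathrm{Mat}_{\mathcal X}(\mathbb C)$ be the matrix representing the action of $z$ in this structure (it is called the weighted adjacency matrix). Then every irreducible $T$-module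 $W$ is invariant under $\mathbf A,\mathbf B,\mathbf C$, and the actions of $\mathbf A,\mathbf B,\mathbf C$ on $W$ form a totally bipartite Leonard triple of Bannai/Ito type. -/

import Mathlib

namespace BannaiIto

section LeonardTriples

variable {K : Type*} [Field K] {V : Type*} [AddCommGroup V] [Module K V]

/-- A square matrix is tridiagonal when each nonzero entry lies on the diagonal, the subdiagonal
or the superdiagonal. -/
def IsTridiagonal {n : ℕ} (M : Matrix (Fin n) (Fin n) K) : Prop :=
  ∀ i j : Fin n, M i j ≠ 0 → (i : ℕ) ≤ j + 1 ∧ (j : ℕ) ≤ i + 1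

/-- A tridiagonal matrix is irreducible when all entries on the subdiagonal and on the
superdiagonal are nonzero. -/
def IsIrreducibleTridiagonal {n : ℕ} (M : Matrix (Fin n) (Fin n) K) : Prop :=
  IsTridiagonal M ∧ ∀ i j : Fin n, ((i : ℕ) = j + 1 ∨ (j : ℕ) = i + 1) → M i j ≠ 0

/-- A (tridiagonal) matrix is bipartite when its diagonal entries are all zero. -/
def IsBipartite {n : ℕ} (M : Matrix (Fin n) (Fin n) K) : Prop :=
  ∀ i : Fin n, M i i = 0

/-- With respect to the basis `b`, the matrix of `f` is diagonal and the matrices of `g` and `h`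
are irreducible tridiagonal. For a Leonard triple `f, g, h` these are the standard bases. -/
def IsStandardBasis {n : ℕ} (f g h : Module.End K V) (b : Module.Basis (Fin n) K V) : Prop :=
  (LinearMap.toMatrix b b f).IsDiag ∧
  IsIrreducibleTridiagonal (LinearMap.toMatrix b b g) ∧
  IsIrreducibleTridiagonal (LinearMap.toMatrix b b h)

/-- Leonard triples on a vector space of finite positive dimension. -/
structure IsLeonardTriple (f g h : Module.End K V) : Prop where
  finrank_pos : 0 < Module.finrank K V
  diag_fst : ∃ b : Module.Basis (Fin (Module.finrank K V)) K V, IsStandardBasis f g h b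
  diag_snd : ∃ b : Module.Basis (Fin (Module.finrank K V)) K V, IsStandardBasis g h f b
  diag_trd : ∃ b : Module.Basis (Fin (Module.finrank K V)) K V, IsStandardBasis h f g b

/-- In every basis in which `f` is diagonal and `g`, `h` are irreducible tridiagonal, the latter
two matrices are bipartite. -/
def BipartiteInStandardBases (f g h : Module.End K V) : Prop :=
  ∀ b : Module.Basis (Fin (Module.finrank K V)) K V, IsStandardBasis f g h b →
    IsBipartite (LinearMap.toMatrix b b g) ∧ IsBipartite (LinearMap.toMatrix b b h)

/-- A Leonard triple is totally bipartite when the six irreducible tridiagonal matrices in its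
definition are bipartite (for every admissible choice of the three bases). -/
structure IsTotallyBipartiteLeonardTriple (f g h : Module.End K V) : Prop where
  isLeonardTriple : IsLeonardTriple f g h
  bipartite_fst : BipartiteInStandardBases f g h
  bipartite_snd : BipartiteInStandardBases g h f
  bipartite_trd : BipartiteInStandardBases h f g

/-- A Leonard triple `f, g, h` on a space of dimension `d + 1` is of Bannai/Ito type when, for a
standard basis with corresponding eigenvalues `θ 0, …, θ d` of `f`, the scalar
`(θ (i-2) - θ (i+1)) / (θ (i-1) - θ i)` equals `-1` for `2 ≤ i ≤ d - 1`.
(Standard bases are unique up to scaling and reversal; we ask this for all of them. The index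
below is `i - 2`.) -/
def IsBannaiItoType (f g h : Module.End K V) : Prop :=
  ∀ b : Module.Basis (Fin (Module.finrank K V)) K V, IsStandardBasis f g h b →
    ∀ θ : Fin (Module.finrank K V) → K, (∀ i, f (b i) = θ i • b i) →
      ∀ (i : ℕ) (hi : i + 3 < Module.finrank K V),
        (θ ⟨i, by omega⟩ - θ ⟨i + 3, hi⟩) / (θ ⟨i + 1, by omega⟩ - θ ⟨i + 2, by omega⟩) = -1

end LeonardTriples

section SpinAlgebra

/-- The three generators of the anticommutator spin algebra. -/
inductive SpinGen : Type
  | x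
  | y
  | z

open FreeAlgebra in
/-- The defining relations `xy + yx = 2z`, `yz + zy = 2x`, `zx + xz = 2y`. -/
inductive SpinRel (K : Type*) [Field K] : FreeAlgebra K SpinGen → FreeAlgebra K SpinGen → Prop
  | xy : SpinRel K (ι K SpinGen.x * ι K SpinGen.y + ι K SpinGen.y * ι K SpinGen.x)
      (2 * ι K SpinGen.z)
  | yz : SpinRel K (ι K SpinGen.y * ι K SpinGen.z + ι K SpinGen.z * ι K SpinGen.y)
      (2 * ι K SpinGen.x)
  | zx : SpinRel K (ι K SpinGen.z * ι K SpinGen.x + ι K SpinGen.x * ι K SpinGen.z)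
      (2 * ι K SpinGen.y)

/-- The anticommutator spin algebra. -/
abbrev SpinAlgebra (K : Type*) [Field K] : Type _ := RingQuot (SpinRel K)

/-- The generators, as elements of the anticommutator spin algebra. -/
def spinGen (K : Type*) [Field K] (s : SpinGen) : SpinAlgebra K :=
  RingQuot.mkAlgHom K (SpinRel K) (FreeAlgebra.ι K s)

end SpinAlgebra

section Graphs

open scoped Classical in
/-- The `i`-th dual idempotent of `G` with respect to the vertex `x`. -/
noncomputable def dualIdempotent {X : Type*} (G : SimpleGraph X) (x : X) (i : ℕ) :
    Matrix X X ℂ :=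
  Matrix.diagonal fun y => if G.dist x y = i then 1 else 0

/-- The Bose-Mesner algebra of `G`: the algebra generated by the adjacency matrix. -/
noncomputable def boseMesner {X : Type*} [Fintype X] [DecidableEq X] (G : SimpleGraph X)
    [DecidableRel G.Adj] : Subalgebra ℂ (Matrix X X ℂ) :=
  Algebra.adjoin ℂ {G.adjMatrix ℂ}

/-- The dual Bose-Mesner algebra of `G` with respect to `x`: the span of the dual idempotents.
(For `i` greater than the diameter, the dual idempotent is `0`.) -/
noncomputable def dualBoseMesner {X : Type*} (G : SimpleGraph X) (x : X) :
    Submodule ℂ (Matrix X X ℂ) :=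
  Submodule.span ℂ (Set.range (dualIdempotent G x))

/-- The Terwilliger algebra of `G` with respect to `x`. -/
noncomputable def terwilliger {X : Type*} [Fintype X] [DecidableEq X] (G : SimpleGraph X)
    [DecidableRel G.Adj] (x : X) : Subalgebra ℂ (Matrix X X ℂ) :=
  Algebra.adjoin ℂ ((boseMesner G : Set (Matrix X X ℂ)) ∪ (dualBoseMesner G x))

/-- `W` is stable under all elements of the matrix algebra `T`. -/
def IsModuleFor {X : Type*} [Fintype X] [DecidableEq X] (T : Subalgebra ℂ (Matrix X X ℂ))
    (W : Submodule ℂ (X → ℂ)) : Prop :=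
  ∀ N ∈ T, ∀ w ∈ W, N.mulVec w ∈ W

/-- `W` is an irreducible `T`-module inside the standard module. -/
def IsIrreducibleModuleFor {X : Type*} [Fintype X] [DecidableEq X]
    (T : Subalgebra ℂ (Matrix X X ℂ)) (W : Submodule ℂ (X → ℂ)) : Prop :=
  IsModuleFor T W ∧ W ≠ ⊥ ∧ ∀ U : Submodule ℂ (X → ℂ), IsModuleFor T U → U ≤ W → U = ⊥ ∨ U = W

/-- The primitive idempotent of the matrix `A` at the `i`-th term of the list `θ 0, …, θ D` of its
distinct eigenvalues, i.e. `∏_{j ≠ i} (A - θ j) / (θ i - θ j)`; it is `0` for `i > D`. -/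
noncomputable def primitiveIdempotent {X : Type*} [Fintype X] [DecidableEq X]
    (A : Matrix X X ℂ) (D : ℕ) (θ : ℕ → ℂ) (i : ℕ) : Matrix X X ℂ :=
  if i ≤ D then Polynomial.aeval A (Lagrange.basis (Finset.range (D + 1)) θ i) else 0

/-- The dual distance matrix with respect to the vertex `x` that is attached to the primitive
idempotent `E`: it is diagonal with `(y,y)`-entry `|X| E x y`. -/
noncomputable def dualDistanceMatrix {X : Type*} [Fintype X] [DecidableEq X]
    (E : Matrix X X ℂ) (x : X) : Matrix X X ℂ :=
  Matrix.diagonal fun y => (Fintype.card X : ℂ) * E x y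

/-- The action of the matrix `N` on an `N`-stable subspace `W` of the standard module. -/
def actionOn {X : Type*} [Fintype X] (N : Matrix X X ℂ) (W : Submodule ℂ (X → ℂ))
    (hN : ∀ w ∈ W, N.mulVecLin w ∈ W) : Module.End ℂ W :=
  N.mulVecLin.restrict hN

end Graphs

section Hypercube

/-- The hypercube `Q_D`: vertices are the 0/1-sequences of length `D`, adjacent when they differ in
exactly one coordinate. -/
def hypercube (D : ℕ) : SimpleGraph (Fin D → Fin 2) where
  Adj u v := hammingDist u v = 1
  symm := ⟨fun u v h => by rw [hammingDist_comm]; exact h⟩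
  loopless := ⟨fun u h => by simp at h⟩

instance (D : ℕ) : DecidableRel (hypercube D).Adj :=
  fun u v => inferInstanceAs (Decidable (hammingDist u v = 1))

/-- The adjacency matrix of `Q_D`. -/
def cubeA (D : ℕ) : Matrix (Fin D → Fin 2) (Fin D → Fin 2) ℂ :=
  (hypercube D).adjMatrix ℂ

/-- The ordering `θ i = (-1)^i (D - 2 i)` of the eigenvalues of `Q_D`
(a `Q`-polynomial ordering for even `D`). -/
def cubeEigenvalue (D i : ℕ) : ℂ := (-1) ^ i * ((D : ℂ) - 2 * i)

/-- The dual adjacency matrix of `Q_D` with respect to the vertex `x` and the ordering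
`(-1)^i (D - 2 i)` of the eigenvalues. -/
noncomputable def cubeB (D : ℕ) (x : Fin D → Fin 2) :
    Matrix (Fin D → Fin 2) (Fin D → Fin 2) ℂ :=
  dualDistanceMatrix (primitiveIdempotent (cubeA D) D (cubeEigenvalue D) 1) x

/-- A module structure `ρ` of the anticommutator spin algebra on the standard module of `Q_D`
in which the generators `x, y` act as the adjacency and the dual adjacency matrix. -/
def IsCubeStructure (D : ℕ) (x : Fin D → Fin 2)
    (ρ : SpinAlgebra ℂ →ₐ[ℂ] Module.End ℂ ((Fin D → Fin 2) → ℂ)) : Prop :=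
  ρ (spinGen ℂ SpinGen.x) = Matrix.toLin' (cubeA D) ∧
  ρ (spinGen ℂ SpinGen.y) = Matrix.toLin' (cubeB D x)

end Hypercube

end BannaiIto

/-! Let `H` be diagonal with entry `D - 2i` at distance `i` from the base vertex, and `P` diagonal
with entry `(-1)^i`. Coordinate by coordinate the cube is a tensor power of `ℂ²` on which `A` and
`H` are sums of Pauli matrices, so they generate an action of `sl₂`; `A = L + R` splits into parts
that lower and raise the distance. `P` commutes with `H` and anticommutes with `A`, hence turns
commutators into anticommutators, and the `sl₂` relations become the spin relations for `A`, `P H`,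
`P (L - R)` (`IsParityPair.xy`, `yz`, `zx`). Expanding the delta function at the base vertex in
characters gives `B = P H` (`toLin'_cubeB`); since `xy + yx = 2z` determines `z`, `C = P (L - R)`.

An irreducible module of the Terwilliger algebra is a single `sl₂`-string `u 0, …, u d` with `D = 2r
+ d` (`exists_isCubeChain`). On it `A² + B² + C²` is the `sl₂` Casimir, equal to `d (d + 2)`, and
each of `A`, `B`, `C` has the eigenvalue `d`.

These data already force the Leonard triple (`IsSpinTriple`). The operators `Y ± Z` reflect
eigenvalues of `X` by `μ ↦ ±2 - μ`; applied alternately to an eigenvector for `d` they run through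
`(-1)^k (d - 2k)`, which are distinct because `d` is even. In the resulting basis `Y` and `Z` are
irreducible tridiagonal. The relations are cyclically symmetric (`IsSpinTriple.rotate`), so only `X`
needs treatment. -/

namespace BannaiIto

/-! ### Leonard triples from spin triples with Casimir value `d (d + 2)`. -/

section SpinTriples

theorem cubeEigenvalue_succ (d k : ℕ) :
    cubeEigenvalue d (k + 1) = 2 * (-1) ^ k - cubeEigenvalue d k := by
  simp only [cubeEigenvalue, pow_succ]
  push_cast
  ring

theorem cubeEigenvalue_eq_intCast (d k : ℕ) :
    cubeEigenvalue d k = (((-1) ^ k * ((d : ℤ) - 2 * k) : ℤ) : ℂ) := by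
  simp [cubeEigenvalue]

/-- For even `d` the values are `d` modulo 4 at even indices and `d + 2` modulo 4 at odd ones. There
is no bound on the indices; index `d + 1` is needed to end the chain. -/
theorem cubeEigenvalue_injective {d : ℕ} (hd : Even d) :
    Function.Injective (cubeEigenvalue d) := by
  intro k l h
  rw [cubeEigenvalue_eq_intCast, cubeEigenvalue_eq_intCast, Int.cast_inj] at h
  obtain ⟨m, rfl⟩ := hd
  rcases Nat.even_or_odd' k with ⟨a, rfl | rfl⟩ <;>
  rcases Nat.even_or_odd' l with ⟨c, rfl | rfl⟩ <;>
  simp [pow_succ, pow_mul] at h <;> omega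

theorem cubeEigenvalue_ne_of_odd {d : ℕ} (hd : Even d) (k : ℕ) {n : ℤ} (hn : Odd n) :
    cubeEigenvalue d k ≠ n := by
  rw [cubeEigenvalue_eq_intCast, Ne, Int.cast_inj]
  rintro rfl
  rw [Int.odd_mul] at hn
  obtain ⟨m, rfl⟩ := hd
  have h := hn.2
  rw [Int.odd_iff] at h
  omega

/-- The excluded value is what the eigenvalue formula gives at index `-1`. -/
theorem cubeEigenvalue_ne_neg_sub_two {d : ℕ} (hd : Even d) {k : ℕ} (hk : k < d + 1) :
    cubeEigenvalue d k ≠ -2 - d := by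
  have e : (-2 - d : ℂ) = ((-2 - d : ℤ) : ℂ) := by push_cast; rfl
  rw [cubeEigenvalue_eq_intCast, e, Ne, Int.cast_inj]
  obtain ⟨m, rfl⟩ := hd
  rcases Nat.even_or_odd' k with ⟨a, rfl | rfl⟩ <;> simp [pow_succ, pow_mul] <;> omega

variable {W : Type*} [AddCommGroup W] [Module ℂ W]

/-- Three endomorphisms that satisfy the relations of the anticommutator spin algebra and on which
the central element `x² + y² + z²` takes the value `d (d + 2)`. -/
structure IsSpinTriple (d : ℕ) (X Y Z : Module.End ℂ W) : Prop where
  xy : X * Y + Y * X = 2 * Z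
  yz : Y * Z + Z * Y = 2 * X
  zx : Z * X + X * Z = 2 * Y
  casimir : X * X + Y * Y + Z * Z = ((d : ℂ) * (d + 2)) • 1

/-- The operator that sends the `k`-th eigenvector of `X` to the next one. -/
def spinShift (Y Z : Module.End ℂ W) (k : ℕ) : Module.End ℂ W := Y + (-1 : ℂ) ^ k • Z

/-- The eigenvectors of `X` obtained from an eigenvector `v` by alternately applying `Y + Z` and
`Y - Z`. -/
def spinChain (Y Z : Module.End ℂ W) (v : W) : ℕ → W
  | 0 => v
  | k + 1 => spinShift Y Z k (spinChain Y Z v k)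

theorem neg_one_pow_cases (k : ℕ) : (-1 : ℂ) ^ k = 1 ∨ (-1 : ℂ) ^ k = -1 :=
  neg_one_pow_eq_or ℂ k

namespace IsSpinTriple

variable {d : ℕ} {X Y Z : Module.End ℂ W}

theorem rotate (h : IsSpinTriple d X Y Z) : IsSpinTriple d Y Z X :=
  ⟨h.yz, h.zx, h.xy, by rw [← h.casimir]; abel⟩

theorem xy_apply (h : IsSpinTriple d X Y Z) (u : W) : X (Y u) = (2 : ℂ) • Z u - Y (X u) := by
  have := congrArg (fun f => f u) h.xy
  simp only [two_mul, LinearMap.add_apply, Module.End.mul_apply] at this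
  rw [eq_sub_iff_add_eq, this, two_smul]

/-- With `ε = ±1`, the anticommutator of `X` with `Y + εZ` is `2Z + 2εY = 2ε(Y + εZ)`. Hence an
eigenvalue `μ` of `X` is reflected to `2ε - μ`. -/
theorem apply_spinShift (h : IsSpinTriple d X Y Z) (k : ℕ) (u : W) :
    X (spinShift Y Z k u) = (2 * (-1) ^ k : ℂ) • spinShift Y Z k u - spinShift Y Z k (X u) := by
  have h1 := h.xy_apply u
  have h2 := h.rotate.rotate.xy_apply u
  have h3 : X (Z u) = (2 : ℂ) • Y u - Z (X u) := by rw [h2]; abel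
  simp only [spinShift, LinearMap.add_apply, LinearMap.smul_apply, map_add, map_smul, h1, h3]
  rcases neg_one_pow_cases k with e | e <;> rw [e] <;> module

/-- `(Y + εZ)² = Y² + Z² + 2εX`, and the Casimir replaces `Y² + Z²` by `d (d + 2) - X²`. -/
theorem spinShift_spinShift (h : IsSpinTriple d X Y Z) {k : ℕ} {u : W}
    (hu : X u = cubeEigenvalue d k • u) :
    spinShift Y Z k (spinShift Y Z k u) = (4 * (k + 1) * (d - k) : ℂ) • u := by
  have h1 := h.rotate.xy_apply u
  have h2 := congrArg (fun f => f u) h.casimir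
  simp only [LinearMap.add_apply, Module.End.mul_apply, LinearMap.smul_apply, Module.End.one_apply,
    hu, map_smul] at h2
  have h3 : Y (Y u) = ((d : ℂ) * (d + 2)) • u - Z (Z u)
      - (cubeEigenvalue d k * cubeEigenvalue d k) • u := by
    rw [← h2]; module
  simp only [spinShift, LinearMap.add_apply, LinearMap.smul_apply, map_add, map_smul, h1, h3, hu]
  simp only [cubeEigenvalue]
  rcases neg_one_pow_cases k with e | e <;> rw [e] <;> module

theorem apply_spinChain (h : IsSpinTriple d X Y Z) {v : W} (hv : X v = (d : ℂ) • v) (k : ℕ) :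
    X (spinChain Y Z v k) = cubeEigenvalue d k • spinChain Y Z v k := by
  induction k with
  | zero => simpa [spinChain, cubeEigenvalue] using hv
  | succ k ih =>
    rw [spinChain, h.apply_spinShift, ih, map_smul, ← sub_smul, cubeEigenvalue_succ]

theorem spinChain_ne_zero (h : IsSpinTriple d X Y Z) {v : W} (hv : X v = (d : ℂ) • v)
    (hv0 : v ≠ 0) {k : ℕ} (hk : k < d + 1) : spinChain Y Z v k ≠ 0 := by
  induction k with
  | zero => exact hv0
  | succ k ih =>
    intro h0
    have h1 := h.spinShift_spinShift (h.apply_spinChain hv k)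
    rw [← spinChain, h0, map_zero, eq_comm, smul_eq_zero] at h1
    refine h1.elim (fun h2 => ?_) (ih (by omega))
    have h3 : (k : ℂ) + 1 ≠ 0 := by exact_mod_cast Nat.succ_ne_zero k
    have h4 : (d : ℂ) - k ≠ 0 := by
      rw [sub_ne_zero]
      exact_mod_cast (by omega : d ≠ k)
    simp [h3, h4] at h2

theorem linearIndependent_spinChain (h : IsSpinTriple d X Y Z) (hd : Even d) {v : W}
    (hv : X v = (d : ℂ) • v) (hv0 : v ≠ 0) {n : ℕ} (hn : n ≤ d + 1) :
    LinearIndependent ℂ (fun i : Fin n => spinChain Y Z v i) := by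
  refine Module.End.eigenvectors_linearIndependent' X (fun i : Fin n => cubeEigenvalue d i)
    ((cubeEigenvalue_injective hd).comp Fin.val_injective) _ fun i => ?_
  exact ⟨Module.End.mem_eigenspace_iff.2 (h.apply_spinChain hv i),
    h.spinChain_ne_zero hv hv0 (by omega)⟩

/-- The chain supplies the lower bound, so a spanning set of size `d + 1` suffices in the
application. -/
theorem finrank_eq [FiniteDimensional ℂ W] (h : IsSpinTriple d X Y Z) (hd : Even d) {v : W}
    (hv : X v = (d : ℂ) • v) (hv0 : v ≠ 0) (hW : Module.finrank ℂ W ≤ d + 1) :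
    Module.finrank ℂ W = d + 1 := by
  have := (h.linearIndependent_spinChain hd hv hv0 le_rfl).fintype_card_le_finrank
  rw [Fintype.card_fin] at this
  omega

theorem exists_basis (h : IsSpinTriple d X Y Z) (hd : Even d) {v : W}
    (hv : X v = (d : ℂ) • v) (hv0 : v ≠ 0) (hW : Module.finrank ℂ W = d + 1) :
    ∃ b : Module.Basis (Fin (Module.finrank ℂ W)) ℂ W, ∀ i, b i = spinChain Y Z v i := by
  have : Nonempty (Fin (Module.finrank ℂ W)) := ⟨⟨0, by omega⟩⟩
  exact ⟨basisOfLinearIndependentOfCardEqFinrank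
    (h.linearIndependent_spinChain hd hv hv0 hW.le) (by simp), fun i => by simp⟩

end IsSpinTriple

theorem repr_eq_zero_of_eigenvalue_ne {ι : Type*} {X : Module.End ℂ W} {b : Module.Basis ι ℂ W}
    {θ : ι → ℂ} (hb : ∀ i, X (b i) = θ i • b i) {u : W} {μ : ℂ} (hu : X u = μ • u) {i : ι}
    (hi : θ i ≠ μ) : b.repr u i = 0 := by
  have key : b.repr (X u) i = θ i * b.repr u i := by
    have : (b.coord i).comp X = θ i • b.coord i := by
      refine b.ext fun j => ?_
      by_cases hj : j = i
      · subst hj; simp [hb]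
      · simp [hb, hj]
    simpa using congrArg (fun f => f u) this
  rw [hu] at key
  simp only [map_smul, Finsupp.smul_apply, smul_eq_mul] at key
  by_contra h0
  exact hi (mul_right_cancel₀ h0 key).symm

theorem eq_zero_of_eigenvalue_ne {ι : Type*} {X : Module.End ℂ W} {b : Module.Basis ι ℂ W}
    {θ : ι → ℂ} (hb : ∀ i, X (b i) = θ i • b i) {u : W} {μ : ℂ} (hu : X u = μ • u)
    (hμ : ∀ i, θ i ≠ μ) : u = 0 :=
  b.repr.map_eq_zero_iff.1 (Finsupp.ext fun i => repr_eq_zero_of_eigenvalue_ne hb hu (hμ i))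

namespace IsSpinTriple

variable {d : ℕ} {X Y Z : Module.End ℂ W}

/-- `Y - Z` would send `v` to eigenvalue `-2 - d`, and `d + 1` other eigenvalues already exhaust the
dimension. -/
theorem spinShift_zero_neighbour (h : IsSpinTriple d X Y Z) (hd : Even d) {v : W}
    (hv : X v = (d : ℂ) • v) (hv0 : v ≠ 0) (hW : Module.finrank ℂ W = d + 1) :
    spinShift Y Z 1 v = 0 := by
  obtain ⟨b, hb⟩ := h.exists_basis hd hv hv0 hW
  have hX : ∀ i, X (b i) = cubeEigenvalue d i • b i := fun i => by
    rw [hb]; exact h.apply_spinChain hv i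
  refine eq_zero_of_eigenvalue_ne hX (μ := -2 - d) ?_
    fun i => cubeEigenvalue_ne_neg_sub_two hd (by omega)
  rw [h.apply_spinShift, hv, map_smul, ← sub_smul]
  congr 1
  ring

theorem spinChain_eq_zero (h : IsSpinTriple d X Y Z) (hd : Even d) {v : W}
    (hv : X v = (d : ℂ) • v) (hv0 : v ≠ 0) (hW : Module.finrank ℂ W = d + 1) :
    spinChain Y Z v (d + 1) = 0 := by
  obtain ⟨b, hb⟩ := h.exists_basis hd hv hv0 hW
  have hX : ∀ i, X (b i) = cubeEigenvalue d i • b i := fun i => by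
    rw [hb]; exact h.apply_spinChain hv i
  refine eq_zero_of_eigenvalue_ne hX (h.apply_spinChain hv (d + 1)) fun i hi => ?_
  have := cubeEigenvalue_injective hd hi
  omega

/-- The vector that precedes the `k`-th one in a chain of eigenvectors, with its coefficient. -/
theorem spinShift_pred (h : IsSpinTriple d X Y Z) (hd : Even d) {v : W}
    (hv : X v = (d : ℂ) • v) (hv0 : v ≠ 0) (hW : Module.finrank ℂ W = d + 1) (k : ℕ) :
    spinShift Y Z (k + 1) (spinChain Y Z v k) =
      (4 * k * (d - k + 1) : ℂ) • spinChain Y Z v (k - 1) := by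
  cases k with
  | zero => simpa [spinChain] using h.spinShift_zero_neighbour hd hv hv0 hW
  | succ k =>
    have h1 := h.spinShift_spinShift (h.apply_spinChain hv k)
    -- The signs have period 2, so stepping back is the same operator that stepped forward, and its
    -- square is known.
    have h2 : spinShift Y Z (k + 1 + 1) = spinShift Y Z k := by
      simp [spinShift, pow_succ]
    rw [h2, spinChain, h1]
    simp only [Nat.add_sub_cancel]
    congr 1
    push_cast
    ring

/-- `Y` is the mean of `Y + Z` and `Y - Z`, one of which moves forward in the chain and the other
backward. -/
theorem apply_spinChain_snd (h : IsSpinTriple d X Y Z) (hd : Even d) {v : W}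
    (hv : X v = (d : ℂ) • v) (hv0 : v ≠ 0) (hW : Module.finrank ℂ W = d + 1) (k : ℕ) :
    Y (spinChain Y Z v k) = (1 / 2 : ℂ) • spinChain Y Z v (k + 1) +
      (2 * k * (d - k + 1) : ℂ) • spinChain Y Z v (k - 1) := by
  have h1 := h.spinShift_pred hd hv hv0 hW k
  have h2 : (2 * k * (d - k + 1) : ℂ) • spinChain Y Z v (k - 1) =
    (1 / 2 : ℂ) • spinShift Y Z (k + 1) (spinChain Y Z v k) := by
    rw [h1, smul_smul]; congr 1; ring
  rw [h2, spinChain]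
  simp only [spinShift, pow_succ, LinearMap.add_apply, LinearMap.smul_apply]
  module

theorem apply_spinChain_trd (h : IsSpinTriple d X Y Z) (hd : Even d) {v : W}
    (hv : X v = (d : ℂ) • v) (hv0 : v ≠ 0) (hW : Module.finrank ℂ W = d + 1) (k : ℕ) :
    Z (spinChain Y Z v k) = ((-1) ^ k / 2 : ℂ) • spinChain Y Z v (k + 1) +
      (-(-1) ^ k * (2 * k * (d - k + 1)) : ℂ) • spinChain Y Z v (k - 1) := by
  have h1 := h.spinShift_pred hd hv hv0 hW k
  have h2 : (-(-1) ^ k * (2 * k * (d - k + 1)) : ℂ) • spinChain Y Z v (k - 1) =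
    (-(-1) ^ k / 2 : ℂ) • spinShift Y Z (k + 1) (spinChain Y Z v k) := by
    rw [h1, smul_smul]; congr 1; ring
  rw [h2, spinChain]
  simp only [spinShift, pow_succ, LinearMap.add_apply, LinearMap.smul_apply]
  rcases neg_one_pow_cases k with e | e <;> rw [e] <;> module

end IsSpinTriple

/-- The ends are absorbed by `u n = 0` and by `q 0 = 0`; the latter removes the spurious term from
`0 - 1 = 0`. -/
theorem isIrreducibleTridiagonal_toMatrix {n : ℕ} {b : Module.Basis (Fin n) ℂ W}
    {Y : Module.End ℂ W} {u : ℕ → W} (hb : ∀ i, b i = u i) (hn : u n = 0) {p q : ℕ → ℂ}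
    (hY : ∀ k < n, Y (u k) = p k • u (k + 1) + q k • u (k - 1)) (hp : ∀ k, p k ≠ 0)
    (hq0 : q 0 = 0) (hq : ∀ k, 0 < k → k < n → q k ≠ 0) :
    IsIrreducibleTridiagonal (LinearMap.toMatrix b b Y) := by
  have key : ∀ i j : Fin n, LinearMap.toMatrix b b Y i j =
      p j * (if (i : ℕ) = j + 1 then 1 else 0) + q j * (if (j : ℕ) = i + 1 then 1 else 0) := by
    intro i j
    have hc : ∀ k ≤ n, b.repr (u k) i = if (i : ℕ) = k then 1 else 0 := by
      intro k hk
      rcases hk.eq_or_lt with rfl | hk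
      · simp [hn, i.2.ne]
      · have := hb ⟨k, hk⟩
        simp only at this
        rw [← this, Module.Basis.repr_self, Finsupp.single_apply]
        simp [Fin.ext_iff, eq_comm]
    rw [LinearMap.toMatrix_apply, hb, hY j j.2]
    simp only [map_add, map_smul, Finsupp.add_apply, Finsupp.smul_apply, smul_eq_mul]
    rw [hc _ (by omega), hc _ (by omega)]
    congr 1
    by_cases hj : (j : ℕ) = 0
    · simp [hj, hq0]
    · congr 1
      simp only [show (i : ℕ) = j - 1 ↔ (j : ℕ) = i + 1 by omega]
  constructor
  · intro i j hij
    rw [key] at hij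
    by_contra hc
    refine hij ?_
    rw [if_neg (by omega), if_neg (by omega)]
    simp
  · rintro i j (hij | hij) <;> rw [key]
    · rw [if_pos hij, if_neg (by omega)]
      simpa using hp j
    · rw [if_neg (by omega), if_pos hij]
      simpa using hq j (by omega) j.2

namespace IsSpinTriple

variable {d : ℕ} {X Y Z : Module.End ℂ W}

theorem exists_isStandardBasis (h : IsSpinTriple d X Y Z) (hd : Even d) {v : W}
    (hv : X v = (d : ℂ) • v) (hv0 : v ≠ 0) (hW : Module.finrank ℂ W = d + 1) :
    ∃ b : Module.Basis (Fin (Module.finrank ℂ W)) ℂ W, IsStandardBasis X Y Z b := by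
  obtain ⟨b, hb⟩ := h.exists_basis hd hv hv0 hW
  have hX : ∀ i, X (b i) = cubeEigenvalue d i • b i := fun i => by
    rw [hb]; exact h.apply_spinChain hv i
  have hend : spinChain Y Z v (Module.finrank ℂ W) = 0 := by
    rw [hW]; exact h.spinChain_eq_zero hd hv hv0 hW
  have hq : ∀ k, 0 < k → k < Module.finrank ℂ W → (2 * k * (d - k + 1) : ℂ) ≠ 0 := by
    intro k hk hkn
    have h1 : (k : ℂ) ≠ 0 := by exact_mod_cast hk.ne'
    have h2 : (d : ℂ) - k + 1 ≠ 0 := by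
      rw [sub_add_eq_add_sub, sub_ne_zero]
      exact_mod_cast (by omega : d + 1 ≠ k)
    simp [h1, h2]
  refine ⟨b, ?_, ?_, ?_⟩
  · intro i j hij
    rw [LinearMap.toMatrix_apply, hX]
    simp [hij.symm]
  · exact isIrreducibleTridiagonal_toMatrix hb hend
      (fun k _ => h.apply_spinChain_snd hd hv hv0 hW k) (by simp) (by simp) hq
  · exact isIrreducibleTridiagonal_toMatrix hb hend
      (fun k _ => h.apply_spinChain_trd hd hv hv0 hW k) (by simp) (by simp)
      fun k h1 h2 => mul_ne_zero (by simp) (hq k h1 h2)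

/-- Every eigenvalue of `X` is a `cubeEigenvalue d k`, and the eigenspaces are lines. -/
theorem exists_eq_smul_of_eigenvector (h : IsSpinTriple d X Y Z) (hd : Even d) {v : W}
    (hv : X v = (d : ℂ) • v) (hv0 : v ≠ 0) (hW : Module.finrank ℂ W = d + 1) {u : W} {μ : ℂ}
    (hu : X u = μ • u) (hu0 : u ≠ 0) :
    ∃ k, μ = cubeEigenvalue d k ∧ ∃ c : ℂ, u = c • spinChain Y Z v k := by
  obtain ⟨b, hb⟩ := h.exists_basis hd hv hv0 hW
  have hX : ∀ i, X (b i) = cubeEigenvalue d i • b i := fun i => by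
    rw [hb]; exact h.apply_spinChain hv i
  by_cases hμ : ∃ i : Fin (Module.finrank ℂ W), cubeEigenvalue d i = μ
  · obtain ⟨i, hi⟩ := hμ
    refine ⟨i, hi.symm, b.repr u i, ?_⟩
    rw [← hb]
    refine b.repr.injective (Finsupp.ext fun j => ?_)
    by_cases hj : i = j
    · simp [hj]
    · rw [repr_eq_zero_of_eigenvalue_ne hX hu]
      · simp [hj]
      · rw [← hi]
        exact fun h => hj (Fin.ext (cubeEigenvalue_injective hd h).symm)
  · push Not at hμ
    exact absurd (eq_zero_of_eigenvalue_ne hX hu hμ) hu0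

theorem apply_of_isDiag {n : ℕ} {b : Module.Basis (Fin n) ℂ W}
    (hb : (LinearMap.toMatrix b b X).IsDiag) (i : Fin n) :
    X (b i) = LinearMap.toMatrix b b X i i • b i := by
  refine b.repr.injective (Finsupp.ext fun j => ?_)
  rw [← LinearMap.toMatrix_apply]
  by_cases hj : j = i
  · simp [hj]
  · rw [hb hj]
    simp [Ne.symm hj]

theorem toMatrix_xy (h : IsSpinTriple d X Y Z) {n : ℕ} {b : Module.Basis (Fin n) ℂ W}
    {θ : Fin n → ℂ} (hb : ∀ i, X (b i) = θ i • b i) (i j : Fin n) :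
    (θ i + θ j) * LinearMap.toMatrix b b Y i j = 2 * LinearMap.toMatrix b b Z i j ∧
    (θ i + θ j) * LinearMap.toMatrix b b Z i j = 2 * LinearMap.toMatrix b b Y i j := by
  have hXm : LinearMap.toMatrix b b X = Matrix.diagonal θ := by
    ext k l
    rw [LinearMap.toMatrix_apply, hb, Matrix.diagonal_apply]
    by_cases hkl : l = k
    · simp [hkl]
    · simp [Ne.symm hkl]
  have h1 := congrArg (fun f => LinearMap.toMatrix b b f i j) h.xy
  have h2 := congrArg (fun f => LinearMap.toMatrix b b f i j) h.zx
  simp only [two_mul, map_add, LinearMap.toMatrix_mul, hXm, Matrix.add_apply,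
    Matrix.diagonal_mul, Matrix.mul_diagonal] at h1 h2
  constructor
  · linear_combination h1
  · linear_combination h2

/-- On the diagonal the relations read `θ y = z` and `θ z = y`, so `(θ² - 1) y = 0 = (θ² - 1) z`.
Every eigenvalue `θ` is an even integer, hence not `±1`. -/
theorem bipartite (h : IsSpinTriple d X Y Z) (hd : Even d) {v : W}
    (hv : X v = (d : ℂ) • v) (hv0 : v ≠ 0) (hW : Module.finrank ℂ W = d + 1) :
    BipartiteInStandardBases X Y Z := by
  intro b hb
  set θ := fun i => LinearMap.toMatrix b b X i i
  have hθ : ∀ i, X (b i) = θ i • b i := apply_of_isDiag hb.1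
  suffices key : ∀ i, LinearMap.toMatrix b b Y i i = 0 ∧ LinearMap.toMatrix b b Z i i = 0 from
    ⟨fun i => (key i).1, fun i => (key i).2⟩
  intro i
  obtain ⟨k, hk, -⟩ := h.exists_eq_smul_of_eigenvector hd hv hv0 hW (hθ i) (b.ne_zero i)
  obtain ⟨h1, h2⟩ := h.toMatrix_xy hθ i i
  have e1 : θ i - 1 ≠ 0 := by
    rw [sub_ne_zero, hk]
    exact_mod_cast cubeEigenvalue_ne_of_odd hd k (n := 1) odd_one
  have e2 : θ i + 1 ≠ 0 := by
    rw [Ne, add_eq_zero_iff_eq_neg, hk]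
    exact_mod_cast cubeEigenvalue_ne_of_odd hd k (n := -1) (by decide)
  have e : (θ i - 1) * (θ i + 1) ≠ 0 := mul_ne_zero e1 e2
  constructor
  · refine (mul_eq_zero.1 ?_).resolve_left e
    linear_combination (θ i / 2) * h1 + h2 / 2
  · refine (mul_eq_zero.1 ?_).resolve_left e
    linear_combination (θ i / 2) * h2 + h1 / 2

/-- A nonzero entry of `Y` next to the diagonal forces consecutive eigenvalues to sum to `±2`. Equal
consecutive sums would give `θ k = θ (k + 2)`, so the sums alternate and `θ i + θ (i+1) = θ (i+2) +
θ (i+3)`. -/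
theorem isBannaiItoType (h : IsSpinTriple d X Y Z) (hd : Even d) {v : W}
    (hv : X v = (d : ℂ) • v) (hv0 : v ≠ 0) (hW : Module.finrank ℂ W = d + 1) :
    IsBannaiItoType X Y Z := by
  intro b hb θ hθ i hi
  -- Eigenspaces of `X` are lines, so equal eigenvalues would make two basis vectors proportional.
  have hinj : Function.Injective θ := by
    intro k l hkl
    by_contra hne
    obtain ⟨m, hm, c, hc⟩ := h.exists_eq_smul_of_eigenvector hd hv hv0 hW (hθ k) (b.ne_zero k)
    obtain ⟨m', hm', c', hc'⟩ := h.exists_eq_smul_of_eigenvector hd hv hv0 hW (hθ l) (b.ne_zero l)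
    obtain rfl : m = m' := cubeEigenvalue_injective hd (by rw [← hm, ← hm', hkl])
    have hc0 : c' ≠ 0 := by
      rintro rfl
      exact b.ne_zero l (by rw [hc', zero_smul])
    have h1 : c' • b k - c • b l = 0 := by
      rw [hc, hc', smul_smul, smul_smul, mul_comm, sub_self]
    have h2 := congrArg (fun u => b.repr u k) h1
    simp [Ne.symm hne] at h2
    exact hc0 h2
  have hsq : ∀ k l : Fin (Module.finrank ℂ W), (l : ℕ) = k + 1 → θ k + θ l = 2 ∨ θ k + θ l = -2 := by
    intro k l hkl
    obtain ⟨h1, h2⟩ := h.toMatrix_xy hθ k l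
    have h0 := hb.2.1.2 k l (Or.inr hkl)
    have h3 : (θ k + θ l - 2) * (θ k + θ l + 2) = 0 := by
      refine (mul_eq_zero.1 ?_).resolve_right h0
      linear_combination (θ k + θ l) * h1 + 2 * h2
    rcases mul_eq_zero.1 h3 with e | e
    · exact Or.inl (by linear_combination e)
    · exact Or.inr (by linear_combination e)
  set p0 : Fin (Module.finrank ℂ W) := ⟨i, by omega⟩
  set p1 : Fin (Module.finrank ℂ W) := ⟨i + 1, by omega⟩
  set p2 : Fin (Module.finrank ℂ W) := ⟨i + 2, by omega⟩
  set p3 : Fin (Module.finrank ℂ W) := ⟨i + 3, hi⟩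
  have n02 : θ p0 ≠ θ p2 := fun e => by simpa [p0, p2] using hinj e
  have n13 : θ p1 ≠ θ p3 := fun e => by simpa [p1, p3] using hinj e
  have n12 : θ p1 - θ p2 ≠ 0 := sub_ne_zero.2 fun e => by simpa [p1, p2] using hinj e
  rw [div_eq_iff n12]
  rcases hsq p0 p1 rfl with a | a <;> rcases hsq p1 p2 rfl with c | c <;>
    rcases hsq p2 p3 rfl with e | e
  · exact absurd (by linear_combination a - c) n02
  · exact absurd (by linear_combination a - c) n02
  · linear_combination a - e
  · exact absurd (by linear_combination c - e) n13
  · exact absurd (by linear_combination c - e) n13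
  · linear_combination a - e
  · exact absurd (by linear_combination a - c) n02
  · exact absurd (by linear_combination a - c) n02

theorem isTotallyBipartiteLeonardTriple [FiniteDimensional ℂ W] (h : IsSpinTriple d X Y Z)
    (hd : Even d) (hW : Module.finrank ℂ W ≤ d + 1)
    (hX : ∃ v, v ≠ 0 ∧ X v = (d : ℂ) • v) (hY : ∃ v, v ≠ 0 ∧ Y v = (d : ℂ) • v)
    (hZ : ∃ v, v ≠ 0 ∧ Z v = (d : ℂ) • v) :
    IsTotallyBipartiteLeonardTriple X Y Z ∧ IsBannaiItoType X Y Z := by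
  obtain ⟨u, hu0, hu⟩ := hX
  obtain ⟨v, hv0, hv⟩ := hY
  obtain ⟨w, hw0, hw⟩ := hZ
  have hW' := h.finrank_eq hd hu hu0 hW
  refine ⟨⟨⟨by omega, h.exists_isStandardBasis hd hu hu0 hW',
    h.rotate.exists_isStandardBasis hd hv hv0 hW',
    h.rotate.rotate.exists_isStandardBasis hd hw hw0 hW'⟩, h.bipartite hd hu hu0 hW',
    h.rotate.bipartite hd hv hv0 hW',
    h.rotate.rotate.bipartite hd hw hw0 hW'⟩, h.isBannaiItoType hd hu hu0 hW'⟩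

end IsSpinTriple

end SpinTriples

/-! ### Actions of `sl₂` with a parity involution. -/

section ParityTriples

variable {V : Type*} [AddCommGroup V] [Module ℂ V]

/-- Two endomorphisms that generate an action of `sl₂`, with an involution that commutes with the
second one and anticommutes with the first one. -/
structure IsParityPair (A H P : Module.End ℂ V) : Prop where
  comm_fst : H * (H * A - A * H) - (H * A - A * H) * H = (4 : ℂ) • A
  comm_snd : A * (A * H - H * A) - (A * H - H * A) * A = (4 : ℂ) • H
  parity_fst : P * A = -(A * P)
  parity_snd : P * H = H * P
  parity_sq : P * P = 1

/-- The raising operator of the pair `A, H`. -/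
noncomputable def raising (A H : Module.End ℂ V) : Module.End ℂ V :=
  (1 / 4 : ℂ) • ((2 : ℂ) • A - (H * A - A * H))

/-- The lowering operator of the pair `A, H`. -/
noncomputable def lowering (A H : Module.End ℂ V) : Module.End ℂ V :=
  (1 / 4 : ℂ) • ((2 : ℂ) • A + (H * A - A * H))

theorem lowering_add_raising (A H : Module.End ℂ V) : lowering A H + raising A H = A := by
  simp only [lowering, raising]; module

namespace IsParityPair

variable {A H P : Module.End ℂ V}

/-- Since `[H, [H, A]] = 4A`, the combinations `2A ∓ [H, A]` are eigenvectors of `ad H` for `∓2`. -/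
theorem snd_mul_raising (h : IsParityPair A H P) :
    H * raising A H = raising A H * H - (2 : ℂ) • raising A H := by
  have h1 := h.comm_fst
  rw [← sub_eq_zero] at h1 ⊢
  have h2 : H * raising A H - (raising A H * H - (2 : ℂ) • raising A H) = (-(1 / 4) : ℂ) •
      (H * (H * A - A * H) - (H * A - A * H) * H - (4 : ℂ) • A) := by
    simp only [raising, mul_smul_comm, smul_mul_assoc, mul_sub, sub_mul, mul_assoc]
    module
  rw [h2, h1, smul_zero]

theorem snd_mul_lowering (h : IsParityPair A H P) :
    H * lowering A H = lowering A H * H + (2 : ℂ) • lowering A H := by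
  have h1 := h.comm_fst
  rw [← sub_eq_zero] at h1 ⊢
  have h2 : H * lowering A H - (lowering A H * H + (2 : ℂ) • lowering A H) = (1 / 4 : ℂ) •
      (H * (H * A - A * H) - (H * A - A * H) * H - (4 : ℂ) • A) := by
    simp only [lowering, mul_smul_comm, smul_mul_assoc, mul_sub, sub_mul, mul_add, add_mul,
      mul_assoc]
    module
  rw [h2, h1, smul_zero]

theorem lowering_mul_raising (h : IsParityPair A H P) :
    lowering A H * raising A H = raising A H * lowering A H + H := by
  have h1 := h.comm_snd
  rw [← sub_eq_zero] at h1 ⊢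
  have h2 : lowering A H * raising A H - (raising A H * lowering A H + H) = (1 / 4 : ℂ) •
      (A * (A * H - H * A) - (A * H - H * A) * A - (4 : ℂ) • H) := by
    simp only [lowering, raising, mul_smul_comm, smul_mul_assoc, mul_sub, sub_mul, mul_add,
      add_mul, mul_assoc]
    module
  rw [h2, h1, smul_zero]

theorem parity_mul_sub (h : IsParityPair A H P) :
    P * (lowering A H - raising A H) = -((lowering A H - raising A H) * P) := by
  have h1 : lowering A H - raising A H = (1 / 2 : ℂ) • (H * A - A * H) := by
    simp only [lowering, raising]; module
  have e1 : P * (H * A) = -(H * (A * P)) := by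
    rw [← mul_assoc, h.parity_snd, mul_assoc, h.parity_fst, mul_neg]
  have e2 : P * (A * H) = -(A * (H * P)) := by
    rw [← mul_assoc, h.parity_fst, neg_mul, mul_assoc, h.parity_snd]
  rw [h1, mul_smul_comm, smul_mul_assoc, mul_sub, e1, e2, sub_mul, mul_assoc, mul_assoc]
  module

/-- The relations of the spin algebra hold for `A`, `P H` and `P (L - R)`. -/
theorem xy (h : IsParityPair A H P) :
    A * (P * H) + P * H * A = 2 * (P * (lowering A H - raising A H)) := by
  have e1 : A * (P * H) = -(P * (A * H)) := by
    rw [← mul_assoc, ← mul_assoc, h.parity_fst, neg_mul, neg_neg]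
  have h1 : lowering A H - raising A H = (1 / 2 : ℂ) • (H * A - A * H) := by
    simp only [lowering, raising]; module
  rw [e1, h1, two_mul, mul_assoc, mul_smul_comm, mul_sub]
  module

/-- The two factors `P` cancel up to sign, leaving `[H, L - R] = 2(L + R)`. -/
theorem yz (h : IsParityPair A H P) :
    P * H * (P * (lowering A H - raising A H)) + P * (lowering A H - raising A H) * (P * H) =
      2 * A := by
  have e1 : P * H * (P * (lowering A H - raising A H)) = H * (lowering A H - raising A H) := by
    rw [h.parity_snd, mul_assoc, ← mul_assoc P P, h.parity_sq, one_mul]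
  have e2 : P * (lowering A H - raising A H) * (P * H) = -((lowering A H - raising A H) * H) := by
    rw [h.parity_mul_sub, neg_mul, mul_assoc, ← mul_assoc P P, h.parity_sq, one_mul]
  have e3 : (2 : Module.End ℂ V) * A = (2 : ℂ) • (lowering A H + raising A H) := by
    rw [lowering_add_raising, two_mul, two_smul]
  rw [e1, e2, e3, mul_sub, h.snd_mul_lowering, h.snd_mul_raising, sub_mul]
  module

/-- Moving `P` to the left leaves `P [L - R, L + R] = 2 P [L, R] = 2 P H`. -/
theorem zx (h : IsParityPair A H P) :
    P * (lowering A H - raising A H) * A + A * (P * (lowering A H - raising A H)) =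
      2 * (P * H) := by
  have e1 : A * (P * (lowering A H - raising A H)) = -(P * (A * (lowering A H - raising A H))) := by
    rw [← mul_assoc, ← mul_assoc, h.parity_fst, neg_mul, neg_neg]
  have e2 : (lowering A H - raising A H) * A - A * (lowering A H - raising A H) = (2 : ℂ) • H := by
    have h1 := h.lowering_mul_raising
    have h2 := lowering_add_raising A H
    generalize lowering A H = L at *
    generalize raising A H = R at *
    subst h2
    simp only [mul_sub, sub_mul, mul_add, add_mul, h1]
    module
  rw [e1, mul_assoc, ← sub_eq_add_neg, ← mul_sub, e2, mul_smul_comm, two_smul, two_mul]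

/-- Parity gives `(P (L - R))² = -(L - R)²`, which combines with `A² = (L + R)²`; the right side is
the `sl₂` Casimir. -/
theorem casimir (h : IsParityPair A H P) :
    A * A + P * H * (P * H) +
      P * (lowering A H - raising A H) * (P * (lowering A H - raising A H)) =
      H * H + (2 : ℂ) • (lowering A H * raising A H + raising A H * lowering A H) := by
  have e1 : P * H * (P * H) = H * H := by
    nth_rw 1 [h.parity_snd]
    rw [mul_assoc, ← mul_assoc P P, h.parity_sq, one_mul]
  have e2 : P * (lowering A H - raising A H) * (P * (lowering A H - raising A H)) =
      -((lowering A H - raising A H) * (lowering A H - raising A H)) := by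
    nth_rw 1 [h.parity_mul_sub]
    rw [neg_mul, mul_assoc, ← mul_assoc P, h.parity_sq, one_mul]
  rw [e1, e2]
  have h2 := lowering_add_raising A H
  generalize lowering A H = L at *
  generalize raising A H = R at *
  have h3 : A * A = (L + R) * (L + R) := by rw [h2]
  rw [h3]
  simp only [mul_sub, sub_mul, mul_add, add_mul]
  module

theorem lowering_raising_pow_apply (h : IsParityPair A H P) {n : ℂ} {w : V}
    (hw : H w = n • w) (hL : lowering A H w = 0) (k : ℕ) :
    H ((raising A H ^ k) w) = (n - 2 * k) • (raising A H ^ k) w ∧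
    lowering A H ((raising A H ^ k) w) = (k * (n - k + 1)) • (raising A H ^ (k - 1)) w := by
  induction k with
  | zero => simp [hw, hL]
  | succ k ih =>
    have h1 := congrArg (fun f => f ((raising A H ^ k) w)) h.snd_mul_raising
    have h2 := congrArg (fun f => f ((raising A H ^ k) w)) h.lowering_mul_raising
    simp only [Module.End.mul_apply, LinearMap.sub_apply, LinearMap.add_apply,
      LinearMap.smul_apply, ih.1, ih.2, map_smul] at h1 h2
    have hR : (raising A H ^ (k + 1)) w = raising A H ((raising A H ^ k) w) := by
      rw [pow_succ', Module.End.mul_apply]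
    constructor
    · rw [hR, h1]
      push_cast
      module
    · rw [hR, h2, Nat.add_sub_cancel]
      rcases k with _ | k
      · simp
      · rw [Nat.add_sub_cancel, ← Module.End.mul_apply, ← pow_succ']
        push_cast
        module

end IsParityPair

/-- The signs `g k` with `g 0 = 1` and `g (k + 1) = s k * g k`. -/
noncomputable def signProd (s : ℕ → ℂ) (k : ℕ) : ℂ := ∏ i ∈ Finset.range k, s i

/-- Rescaling `u k` by `signProd s k` turns `M` into `L + R` on an `sl₂`-string, where `exp R`
applied to the first vector has eigenvalue `d`. -/
theorem apply_sum_signProd {M : Module.End ℂ V} {u : ℕ → V} {s : ℕ → ℂ} {d : ℕ}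
    (hs : ∀ k, s k * s k = 1)
    (hM : ∀ k, M (u k) = s k • u (k + 1) + (s (k - 1) * (k * (d - k + 1))) • u (k - 1))
    (hu : u (d + 1) = 0) :
    M (∑ k ∈ Finset.range (d + 1), (signProd s k / k.factorial) • u k) =
      (d : ℂ) • ∑ k ∈ Finset.range (d + 1), (signProd s k / k.factorial) • u k := by
  -- The truncated sum is an eigenvector up to boundary terms; at `n = d` one has the right
  -- coefficient and the other is killed by `hu`.
  have key : ∀ n, M (∑ k ∈ Finset.range (n + 1), (signProd s k / k.factorial) • u k) =
      (d : ℂ) • ∑ k ∈ Finset.range n, (signProd s k / k.factorial) • u k +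
      (n * (signProd s n / n.factorial)) • u n +
      ((n + 1) * (signProd s (n + 1) / (n + 1).factorial)) • u (n + 1) := by
    intro n
    induction n with
    | zero =>
      simp [hM, signProd]
    | succ n ih =>
      rw [Finset.sum_range_succ, map_add, ih, map_smul, hM, Finset.sum_range_succ,
        Nat.add_sub_cancel]
      have e1 : signProd s (n + 2) = signProd s (n + 1) * s (n + 1) :=
        Finset.prod_range_succ _ _
      have e2 : signProd s (n + 1) = signProd s n * s n := Finset.prod_range_succ _ _
      have h0 : (n.factorial : ℂ) ≠ 0 := by exact_mod_cast n.factorial_ne_zero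
      have h1 : (n : ℂ) + 1 ≠ 0 := by exact_mod_cast n.succ_ne_zero
      have h2 : (n : ℂ) + 1 + 1 ≠ 0 := by exact_mod_cast (n + 1).succ_ne_zero
      have a1 : ((n : ℂ) + 1 + 1) * (signProd s (n + 2) / (n + 2).factorial) =
          (signProd s (n + 1) / (n + 1).factorial) * s (n + 1) := by
        rw [e1, Nat.factorial_succ (n + 1)]
        have h3 : ((n + 1).factorial : ℂ) ≠ 0 := by exact_mod_cast (n + 1).factorial_ne_zero
        push_cast
        field_simp
      have a2 : (signProd s (n + 1) / (n + 1).factorial) * (s n * ((n + 1) * (d - (n + 1) + 1))) =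
          (d - n) * (signProd s n / n.factorial) := by
        rw [e2, Nat.factorial_succ]
        push_cast
        field_simp
        linear_combination ((d : ℂ) - n) * signProd s n * hs n
      rw [smul_add, smul_smul, smul_smul]
      push_cast
      rw [a1, a2]
      module
  rw [key, hu, smul_zero, add_zero, Finset.sum_range_succ, smul_add, smul_smul]

end ParityTriples

/-! ### Flips and signs on the cube, and the dual adjacency matrix. -/

section CubeOperators

/-- Only equal indices contribute: `[∑ t, s i] = 2 t i s i`, and a second commutator gives `4 (t i)²
s i`. Flips and signs can play either role, which yields both `sl₂` relations. -/
theorem double_commutator_sum {ι M : Type*} [Fintype ι] [DecidableEq ι] [Ring M] {s t : ι → M}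
    (hsq : ∀ i, t i * t i = 1) (htt : ∀ i j, t i * t j = t j * t i)
    (hanti : ∀ i, s i * t i = -(t i * s i)) (hcomm : ∀ i j, i ≠ j → t i * s j = s j * t i) :
    (∑ i, t i) * ((∑ i, t i) * (∑ i, s i) - (∑ i, s i) * (∑ i, t i)) -
      ((∑ i, t i) * (∑ i, s i) - (∑ i, s i) * (∑ i, t i)) * (∑ i, t i) = 4 * ∑ i, s i := by
  have h1 : ∀ i, (∑ j, t j) * s i - s i * (∑ j, t j) = 2 * (t i * s i) := by
    intro i
    rw [Finset.sum_mul, Finset.mul_sum, ← Finset.sum_sub_distrib,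
      Finset.sum_eq_single i (fun j _ hj => by rw [hcomm j i hj, sub_self]) (by simp), hanti]
    noncomm_ring
  have h2 : (∑ i, t i) * (∑ i, s i) - (∑ i, s i) * (∑ i, t i) = ∑ i, 2 * (t i * s i) := by
    rw [Finset.mul_sum, Finset.sum_mul, ← Finset.sum_sub_distrib]
    exact Finset.sum_congr rfl fun i _ => h1 i
  have h3 : ∀ i, (∑ j, t j) * (2 * (t i * s i)) - 2 * (t i * s i) * (∑ j, t j) = 4 * s i := by
    intro i
    have e : (∑ j, t j) * t i = t i * ∑ j, t j := by
      rw [Finset.sum_mul, Finset.mul_sum]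
      exact Finset.sum_congr rfl fun j _ => htt j i
    calc (∑ j, t j) * (2 * (t i * s i)) - 2 * (t i * s i) * (∑ j, t j)
        = 2 * ((∑ j, t j) * t i * s i - t i * s i * (∑ j, t j)) := by noncomm_ring
      _ = 2 * (t i * ((∑ j, t j) * s i - s i * (∑ j, t j))) := by rw [e]; noncomm_ring
      _ = 4 * (t i * t i * s i) := by rw [h1]; noncomm_ring
      _ = 4 * s i := by rw [hsq, one_mul]
  rw [h2, Finset.mul_sum, Finset.sum_mul, ← Finset.sum_sub_distrib, Finset.mul_sum]
  exact Finset.sum_congr rfl fun i _ => h3 i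

variable {D : ℕ}

/-- The vertex obtained from `y` by changing the `i`-th coordinate. -/
def flipAt (i : Fin D) (y : Fin D → Fin 2) : Fin D → Fin 2 := y + Pi.single i 1

/-- The operator on functions that is induced by changing the `i`-th coordinate. -/
def flipOp (i : Fin D) : Module.End ℂ ((Fin D → Fin 2) → ℂ) := LinearMap.funLeft ℂ ℂ (flipAt i)

/-- The function with value `1` at `y` if `y` and `x` agree at `i`, and `-1` otherwise. -/
def coordSign (x : Fin D → Fin 2) (i : Fin D) (y : Fin D → Fin 2) : ℂ :=
  if x i = y i then 1 else -1

/-- Multiplication by a function. -/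
def mulOp (a : (Fin D → Fin 2) → ℂ) : Module.End ℂ ((Fin D → Fin 2) → ℂ) := LinearMap.mulLeft ℂ a

/-- The operator `∑ i, coordSign x i`, with eigenvalue `D - 2 i` at distance `i` from `x`. -/
def heightOp (x : Fin D → Fin 2) : Module.End ℂ ((Fin D → Fin 2) → ℂ) :=
  mulOp (∑ i, coordSign x i)

/-- The parity operator, with eigenvalue `(-1) ^ i` at distance `i` from `x`. -/
def parityOp (x : Fin D → Fin 2) : Module.End ℂ ((Fin D → Fin 2) → ℂ) :=
  mulOp (∏ i, coordSign x i)

theorem flipOp_apply (i : Fin D) (f : (Fin D → Fin 2) → ℂ) (y : Fin D → Fin 2) :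
    flipOp i f y = f (flipAt i y) := rfl

theorem mulOp_apply (a f : (Fin D → Fin 2) → ℂ) (y : Fin D → Fin 2) :
    mulOp a f y = a y * f y := rfl

theorem mulOp_mul (a b : (Fin D → Fin 2) → ℂ) : mulOp a * mulOp b = mulOp (a * b) := by
  refine LinearMap.ext fun f => funext fun y => ?_; simp [mulOp_apply, mul_assoc]

theorem flipAt_flipAt (i : Fin D) (y : Fin D → Fin 2) : flipAt i (flipAt i y) = y := by
  rw [flipAt, flipAt, add_assoc, ← Pi.single_add]
  simp

theorem coordSign_flipAt_self (x : Fin D → Fin 2) (i : Fin D) (y : Fin D → Fin 2) :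
    coordSign x i (flipAt i y) = -coordSign x i y := by
  simp only [coordSign, flipAt, Pi.add_apply, Pi.single_eq_same]
  generalize x i = a
  generalize y i = b
  fin_cases a <;> fin_cases b <;> simp

theorem coordSign_flipAt_of_ne (x : Fin D → Fin 2) {i j : Fin D} (h : i ≠ j) (y : Fin D → Fin 2) :
    coordSign x i (flipAt j y) = coordSign x i y := by
  simp [coordSign, flipAt, h]

theorem coordSign_mul_self (x : Fin D → Fin 2) (i : Fin D) :
    coordSign x i * coordSign x i = 1 := by
  funext y
  simp only [coordSign, Pi.mul_apply, Pi.one_apply]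
  split_ifs <;> simp

theorem flipOp_mul_self (i : Fin D) : flipOp i * flipOp i = 1 := by
  refine LinearMap.ext fun f => funext fun y => ?_; simp [flipOp_apply, flipAt_flipAt]

theorem flipOp_comm (i j : Fin D) : flipOp i * flipOp j = flipOp j * flipOp i := by
  refine LinearMap.ext fun f => funext fun y => ?_
  simp only [Module.End.mul_apply, flipOp_apply, flipAt]
  congr 1
  abel

theorem flipOp_mul_coordSign_self (x : Fin D → Fin 2) (i : Fin D) :
    flipOp i * mulOp (coordSign x i) = -(mulOp (coordSign x i) * flipOp i) := by
  refine LinearMap.ext fun f => funext fun y => ?_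
  simp [flipOp_apply, mulOp_apply, coordSign_flipAt_self]

theorem coordSign_mul_flipOp_of_ne (x : Fin D → Fin 2) (i j : Fin D) (h : i ≠ j) :
    mulOp (coordSign x i) * flipOp j = flipOp j * mulOp (coordSign x i) := by
  refine LinearMap.ext fun f => funext fun y => ?_
  simp [flipOp_apply, mulOp_apply, coordSign_flipAt_of_ne x h]

theorem heightOp_eq_sum (x : Fin D → Fin 2) : heightOp x = ∑ i, mulOp (coordSign x i) := by
  refine LinearMap.ext fun f => funext fun y => ?_
  simp [heightOp, mulOp_apply, Finset.sum_mul]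

theorem prod_coordSign_mul_self (x : Fin D → Fin 2) :
    (∏ i, coordSign x i) * (∏ i, coordSign x i) = 1 := by
  rw [← Finset.prod_mul_distrib, Finset.prod_eq_one fun i _ => coordSign_mul_self x i]

theorem prod_coordSign_flipAt (x : Fin D → Fin 2) (S : Finset (Fin D)) (j : Fin D)
    (y : Fin D → Fin 2) : ∏ i ∈ S, coordSign x i (flipAt j y) =
      (if j ∈ S then -1 else 1) * ∏ i ∈ S, coordSign x i y := by
  split_ifs with hj
  · rw [← Finset.mul_prod_erase _ _ hj, ← Finset.mul_prod_erase _ _ hj, coordSign_flipAt_self,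
      Finset.prod_congr rfl fun i hi => coordSign_flipAt_of_ne x (Finset.ne_of_mem_erase hi) y]
    ring
  · rw [one_mul]
    exact Finset.prod_congr rfl fun i hi =>
      coordSign_flipAt_of_ne x (ne_of_mem_of_not_mem hi hj) y

theorem isParityPair_flip (x : Fin D → Fin 2) :
    IsParityPair (∑ i, flipOp i) (heightOp x) (parityOp x) where
  comm_fst := by
    rw [heightOp_eq_sum, double_commutator_sum _ _ (flipOp_mul_coordSign_self x)
      (coordSign_mul_flipOp_of_ne x)]
    · rw [← map_ofNat (algebraMap ℂ (Module.End ℂ ((Fin D → Fin 2) → ℂ))) 4, ← Algebra.smul_def]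
    · intro i
      rw [mulOp_mul, coordSign_mul_self]
      refine LinearMap.ext fun f => funext fun y => ?_
      simp [mulOp_apply]
    · intro i j
      rw [mulOp_mul, mulOp_mul, mul_comm]
  comm_snd := by
    rw [heightOp_eq_sum, double_commutator_sum flipOp_mul_self flipOp_comm
      (fun i => by rw [flipOp_mul_coordSign_self, neg_neg])
      (fun i j hij => (coordSign_mul_flipOp_of_ne x j i hij.symm).symm)]
    rw [← map_ofNat (algebraMap ℂ (Module.End ℂ ((Fin D → Fin 2) → ℂ))) 4, ← Algebra.smul_def]
  parity_fst := by
    rw [Finset.mul_sum, Finset.sum_mul, ← Finset.sum_neg_distrib]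
    refine Finset.sum_congr rfl fun i _ => ?_
    refine LinearMap.ext fun f => funext fun y => ?_
    simp [parityOp, flipOp_apply, mulOp_apply, prod_coordSign_flipAt]
  parity_snd := by
    rw [parityOp, heightOp, mulOp_mul, mulOp_mul, mul_comm]
  parity_sq := by
    rw [parityOp, mulOp_mul, prod_coordSign_mul_self]
    refine LinearMap.ext fun f => funext fun y => ?_
    simp [mulOp_apply]

theorem sum_coordSign_apply (x y : Fin D → Fin 2) :
    (∑ i, coordSign x i) y = (D : ℂ) - 2 * hammingDist x y := by
  rw [Finset.sum_apply]
  simp only [coordSign, hammingDist]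
  rw [Finset.sum_ite]
  have h := Finset.card_filter_add_card_filter_not (s := (Finset.univ : Finset (Fin D)))
    (fun i => x i = y i)
  rw [Finset.card_univ, Fintype.card_fin] at h
  have h' : (D : ℂ) = _ := congrArg Nat.cast h.symm
  rw [h']
  simp
  ring

theorem prod_coordSign_apply (x y : Fin D → Fin 2) :
    (∏ i, coordSign x i) y = (-1) ^ hammingDist x y := by
  rw [Finset.prod_apply]
  simp only [coordSign, hammingDist]
  rw [Finset.prod_ite]
  simp

theorem hammingDist_flipAt (y : Fin D → Fin 2) (i : Fin D) : hammingDist y (flipAt i y) = 1 := by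
  rw [hammingDist, Finset.card_eq_one]
  refine ⟨i, ?_⟩
  ext j
  by_cases h : j = i
  · subst h; simp [flipAt]
  · simp [flipAt, h]

theorem eq_flipAt_iff {y z : Fin D → Fin 2} (i : Fin D) :
    z = flipAt i y ↔ ∀ j, (y j ≠ z j ↔ j = i) := by
  constructor
  · rintro rfl j
    by_cases h : j = i
    · subst h; simp [flipAt]
    · simp [flipAt, h]
  · intro h
    funext j
    have h1 := h j
    by_cases hj : j = i
    · subst hj
      simp only [flipAt, Pi.add_apply, Pi.single_eq_same]
      simp only [iff_true] at h1
      revert h1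
      generalize y j = a
      generalize z j = b
      fin_cases a <;> fin_cases b <;> simp
    · simp only [hj, iff_false, not_not] at h1
      simp [flipAt, hj, h1]

theorem hammingDist_eq_one_iff {y z : Fin D → Fin 2} :
    hammingDist y z = 1 ↔ ∃ i, z = flipAt i y := by
  constructor
  · intro h
    obtain ⟨i, hi⟩ := Finset.card_eq_one.1 h
    refine ⟨i, (eq_flipAt_iff i).2 fun j => ?_⟩
    simpa using Finset.ext_iff.1 hi j
  · rintro ⟨i, rfl⟩
    exact hammingDist_flipAt y i

theorem flipAt_injective (y : Fin D → Fin 2) : Function.Injective fun i => flipAt i y := by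
  intro i j h
  exact ((eq_flipAt_iff j).1 h i).1 (((eq_flipAt_iff i).1 rfl i).2 rfl)

theorem toLin'_cubeA : Matrix.toLin' (cubeA D) = ∑ i, flipOp i := by
  refine LinearMap.ext fun f => funext fun y => ?_
  rw [Matrix.toLin'_apply, cubeA, SimpleGraph.adjMatrix_mulVec_apply, LinearMap.sum_apply,
    Finset.sum_apply]
  have h : (hypercube D).neighborFinset y = Finset.univ.image fun i => flipAt i y := by
    ext z
    rw [SimpleGraph.mem_neighborFinset]
    simp only [Finset.mem_image, Finset.mem_univ, true_and]
    exact hammingDist_eq_one_iff.trans (exists_congr fun i => eq_comm)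
  rw [h, Finset.sum_image fun i _ j _ hij => flipAt_injective y hij]
  rfl

theorem hypercube_adj_flipAt (y : Fin D → Fin 2) (i : Fin D) : (hypercube D).Adj y (flipAt i y) :=
  hammingDist_flipAt y i

theorem hammingDist_le_length {y z : Fin D → Fin 2} (p : (hypercube D).Walk y z) :
    hammingDist y z ≤ p.length := by
  induction p with
  | nil => simp
  | @cons u v w h p ih =>
    have h1 : hammingDist u v = 1 := h
    have := hammingDist_triangle u v w
    rw [SimpleGraph.Walk.length_cons]
    omega

theorem exists_walk_length_eq (n : ℕ) (y z : Fin D → Fin 2) (h : hammingDist y z = n) :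
    ∃ p : (hypercube D).Walk y z, p.length = n := by
  induction n generalizing y with
  | zero =>
    obtain rfl := hammingDist_eq_zero.1 h
    exact ⟨.nil, rfl⟩
  | succ n ih =>
    have hne : (Finset.univ.filter fun i => y i ≠ z i).Nonempty := by
      rw [← Finset.card_pos]
      exact n.succ_pos.trans_eq h.symm
    obtain ⟨i, hi⟩ := hne
    have h1 : (Finset.univ.filter fun j => flipAt i y j ≠ z j) =
        (Finset.univ.filter fun j => y j ≠ z j).erase i := by
      ext j
      rw [Finset.mem_erase, Finset.mem_filter, Finset.mem_filter]
      by_cases hj : j = i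
      · subst hj
        simp only [Finset.mem_filter, Finset.mem_univ, true_and, flipAt, Pi.add_apply,
          Pi.single_eq_same] at hi ⊢
        revert hi
        generalize y j = a
        generalize z j = b
        fin_cases a <;> fin_cases b <;> simp
      · simp [flipAt, hj]
    obtain ⟨p, hp⟩ := ih (flipAt i y) (by
      rw [hammingDist, h1, Finset.card_erase_of_mem hi]
      exact (congrArg (· - 1) h).trans (n.add_sub_cancel 1))
    exact ⟨.cons (hypercube_adj_flipAt y i) p, by rw [SimpleGraph.Walk.length_cons, hp]⟩

theorem hypercube_dist (y z : Fin D → Fin 2) : (hypercube D).dist y z = hammingDist y z := by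
  obtain ⟨p, hp⟩ := exists_walk_length_eq _ y z rfl
  obtain ⟨q, hq⟩ := p.reachable.exists_walk_length_eq_dist
  exact le_antisymm (hp ▸ SimpleGraph.dist_le p) (hq ▸ hammingDist_le_length q)

/-- The eigenvectors of the adjacency matrix that are normalized at `x`. -/
def cubeCharacter (x : Fin D → Fin 2) (S : Finset (Fin D)) : (Fin D → Fin 2) → ℂ :=
  ∏ i ∈ S, coordSign x i

theorem toLin'_cubeA_cubeCharacter (x : Fin D → Fin 2) (S : Finset (Fin D)) :
    Matrix.toLin' (cubeA D) (cubeCharacter x S) = ((D : ℂ) - 2 * S.card) • cubeCharacter x S := by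
  rw [toLin'_cubeA]
  funext y
  rw [LinearMap.sum_apply, Finset.sum_apply]
  simp only [flipOp_apply, cubeCharacter, Finset.prod_apply, prod_coordSign_flipAt,
    Pi.smul_apply, smul_eq_mul]
  rw [← Finset.sum_mul, Finset.sum_ite]
  have h := Finset.card_filter_add_card_filter_not (s := (Finset.univ : Finset (Fin D)))
    (fun i => i ∈ S)
  rw [Finset.card_univ, Fintype.card_fin] at h
  have h' : (D : ℂ) = _ := congrArg Nat.cast h.symm
  rw [h']
  simp only [Finset.sum_const, nsmul_eq_mul, Finset.filter_mem_eq_inter, Finset.univ_inter]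
  push_cast
  ring

/-- The sum is the expansion of `∏ (1 + coordSign x i)`, where any coordinate differing from `x`
contributes a factor zero. -/
theorem sum_cubeCharacter (x : Fin D → Fin 2) :
    ∑ S, cubeCharacter x S = (2 ^ D : ℂ) • Pi.single x 1 := by
  funext y
  have h1 : (∑ S, cubeCharacter x S) y = ∏ i, (1 + coordSign x i y) := by
    rw [Finset.prod_one_add, Finset.sum_apply, Finset.powerset_univ]
    exact Finset.sum_congr rfl fun S _ => Finset.prod_apply _ _ _
  rw [h1, Pi.smul_apply, smul_eq_mul]
  by_cases h : y = x
  · subst h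
    simp [coordSign, one_add_one_eq_two]
  · obtain ⟨i, hi⟩ := Function.ne_iff.1 h
    rw [Finset.prod_eq_zero (Finset.mem_univ i) (by simp [coordSign, Ne.symm hi]),
      Pi.single_eq_of_ne h, mul_zero]

theorem isSymm_aeval {X : Type*} [Fintype X] [DecidableEq X] {A : Matrix X X ℂ} (hA : A.IsSymm)
    (p : Polynomial ℂ) : (Polynomial.aeval A p).IsSymm := by
  rw [Matrix.IsSymm, Polynomial.aeval_eq_sum_range, Matrix.transpose_sum]
  exact Finset.sum_congr rfl fun i _ => by rw [Matrix.transpose_smul, Matrix.transpose_pow, hA]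

theorem aeval_apply_of_eigenvector {V : Type*} [AddCommGroup V] [Module ℂ V] {f : Module.End ℂ V}
    {μ : ℂ} {v : V} (h : f v = μ • v) (p : Polynomial ℂ) :
    Polynomial.aeval f p v = p.eval μ • v := by
  by_cases hv : v = 0
  · simp [hv]
  · exact Module.End.aeval_apply_of_hasEigenvector ⟨Module.End.mem_eigenspace_iff.2 h, hv⟩

/-- For even `D`, the number `D - 2s` sits at index `s` of the ordering if `s` is even and at index
`D - s` if `s` is odd. Index 1 therefore means `s = D - 1`. -/
theorem eval_basis_one (hD : Even D) (hD0 : 0 < D) {s : ℕ} (hs : s ≤ D) :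
    (Lagrange.basis (Finset.range (D + 1)) (cubeEigenvalue D) 1).eval ((D : ℂ) - 2 * s) =
      if s = D - 1 then 1 else 0 := by
  obtain ⟨m, hm⟩ := hD
  have key : ∀ j, j ≤ D → (D : ℂ) - 2 * s = cubeEigenvalue D j →
      (Lagrange.basis (Finset.range (D + 1)) (cubeEigenvalue D) 1).eval ((D : ℂ) - 2 * s) =
      if j = 1 then 1 else 0 := by
    intro j hj h
    rw [h]
    split_ifs with h1
    · subst h1
      exact Lagrange.eval_basis_self ((cubeEigenvalue_injective ⟨m, hm⟩).injOn) (by simp; omega)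
    · exact Lagrange.eval_basis_of_ne (Ne.symm h1) (by simp; omega)
  rcases Nat.even_or_odd s with he | ho
  · rw [key s hs (by rw [cubeEigenvalue, he.neg_one_pow, one_mul])]
    obtain ⟨a, ha⟩ := he
    congr 1
    exact propext (by omega)
  · rw [key (D - s) (by omega)]
    · congr 1
      exact propext (by omega)
    · have : Odd (D - s) := Nat.Even.sub_odd hs ⟨m, hm⟩ ho
      rw [cubeEigenvalue, this.neg_one_pow, Nat.cast_sub hs]
      ring

/-- The sets of size `D - 1` are complements of singletons, and omitting a sign from the full
product equals multiplying by it once more. -/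
theorem sum_cubeCharacter_compl_singleton (hD : 0 < D) (x y : Fin D → Fin 2) :
    ∑ S : Finset (Fin D), (if S.card = D - 1 then 1 else 0) * cubeCharacter x S y =
      (∏ i, coordSign x i y) * ∑ i, coordSign x i y := by
  rw [← Equiv.sum_comp (Equiv.ofBijective (compl : Finset (Fin D) → _) compl_bijective)]
  simp only [Equiv.ofBijective_apply, Finset.card_compl, Fintype.card_fin]
  have h1 : ∀ S : Finset (Fin D), (if D - S.card = D - 1 then (1 : ℂ) else 0) =
      if S ∈ Finset.powersetCard 1 Finset.univ then 1 else 0 := by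
    intro S
    have h2 : S.card ≤ D := by simpa using S.card_le_univ
    congr 1
    simp only [Finset.mem_powersetCard, Finset.subset_univ, true_and, eq_iff_iff]
    omega
  simp only [h1, ite_mul, one_mul, zero_mul]
  rw [Finset.sum_ite_mem, Finset.univ_inter, Finset.powersetCard_one, Finset.sum_map,
    Finset.mul_sum]
  refine Finset.sum_congr rfl fun i _ => ?_
  have h3 : coordSign x i y * coordSign x i y = 1 := congrFun (coordSign_mul_self x i) y
  rw [← Finset.prod_compl_mul_prod {i}, Finset.prod_singleton, mul_assoc, h3, mul_one,
    cubeCharacter, Finset.prod_apply]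
  rfl

/-- By symmetry the entry is the value at `y` of the idempotent applied to the delta function at
`x`. In the character expansion it keeps exactly the sets of size `D - 1`. -/
theorem card_mul_primitiveIdempotent (hD : Even D) (x y : Fin D → Fin 2) :
    (Fintype.card (Fin D → Fin 2) : ℂ) *
      primitiveIdempotent (cubeA D) D (cubeEigenvalue D) 1 x y =
      (∏ i, coordSign x i y) * ∑ i, coordSign x i y := by
  rcases Nat.eq_zero_or_pos D with rfl | hD0
  -- For `D = 0` index 1 is out of range, so the idempotent is zero, and the sum of signs is empty.
  · simp [primitiveIdempotent]
  rw [primitiveIdempotent, if_pos (by omega)]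
  set p := Lagrange.basis (Finset.range (D + 1)) (cubeEigenvalue D) 1
  have hsymm : (cubeA D).IsSymm := SimpleGraph.transpose_adjMatrix _
  have h1 : Polynomial.aeval (cubeA D) p x y =
      Polynomial.aeval (Matrix.toLin' (cubeA D)) p (Pi.single x 1) y := by
    have e : Polynomial.aeval (Matrix.toLin' (cubeA D)) p =
        Matrix.toLin' (Polynomial.aeval (cubeA D) p) :=
      Polynomial.aeval_algHom_apply (Matrix.toLinAlgEquiv' (R := ℂ)) (cubeA D) p
    rw [e, Matrix.toLin'_apply, Matrix.mulVec_single_one, Matrix.col_apply]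
    exact ((isSymm_aeval hsymm p).apply x y).symm
  have h2 : (Fintype.card (Fin D → Fin 2) : ℂ) • (Pi.single x 1 : (Fin D → Fin 2) → ℂ) =
      ∑ S, cubeCharacter x S := by
    rw [sum_cubeCharacter]; simp
  rw [h1, ← smul_eq_mul, ← Pi.smul_apply, ← map_smul, h2, map_sum, Finset.sum_apply]
  rw [← sum_cubeCharacter_compl_singleton hD0]
  refine Finset.sum_congr rfl fun S _ => ?_
  rw [aeval_apply_of_eigenvector (toLin'_cubeA_cubeCharacter x S),
    eval_basis_one hD hD0 (by simpa using S.card_le_univ)]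
  rfl

theorem toLin'_cubeB (hD : Even D) (x : Fin D → Fin 2) :
    Matrix.toLin' (cubeB D x) = parityOp x * heightOp x := by
  refine LinearMap.ext fun f => funext fun y => ?_
  rw [Matrix.toLin'_apply, cubeB, dualDistanceMatrix, Matrix.mulVec_diagonal,
    card_mul_primitiveIdempotent hD, parityOp, heightOp, mulOp_mul, mulOp_apply, Pi.mul_apply,
    Finset.prod_apply, Finset.sum_apply]

end CubeOperators

/-! ### Algebra maps out of the spin algebra. -/

section SpinRepresentations

theorem spinGen_add_mul (K : Type*) [Field K] :
    spinGen K .x * spinGen K .y + spinGen K .y * spinGen K .x = 2 * spinGen K .z := by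
  have := RingQuot.mkAlgHom_rel K (SpinRel.xy (K := K))
  rw [map_add, map_mul, map_mul, map_mul, map_ofNat] at this
  exact this

theorem spinAlgHom_apply_z {M : Type*} [Ring M] [Algebra ℂ M] (ρ : SpinAlgebra ℂ →ₐ[ℂ] M) {X Y Z : M}
    (hX : ρ (spinGen ℂ .x) = X) (hY : ρ (spinGen ℂ .y) = Y) (h : X * Y + Y * X = 2 * Z) :
    ρ (spinGen ℂ .z) = Z := by
  have h1 := congrArg ρ (spinGen_add_mul ℂ)
  simp only [map_add, map_mul, map_ofNat, hX, hY, h] at h1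
  have h2 : (2 : ℂ) • Z = (2 : ℂ) • ρ (spinGen ℂ .z) := by
    rw [two_smul, two_smul, ← two_mul, ← two_mul, h1]
  exact (smul_right_injective M (two_ne_zero (α := ℂ)) h2).symm

theorem existsUnique_spinAlgHom {M : Type*} [Ring M] [Algebra ℂ M] {X Y Z : M}
    (xy : X * Y + Y * X = 2 * Z) (yz : Y * Z + Z * Y = 2 * X) (zx : Z * X + X * Z = 2 * Y) :
    ∃! ρ : SpinAlgebra ℂ →ₐ[ℂ] M, ρ (spinGen ℂ .x) = X ∧ ρ (spinGen ℂ .y) = Y := by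
  let g : SpinGen → M := fun s => match s with
    | .x => X
    | .y => Y
    | .z => Z
  have hg : ∀ ⦃a b : FreeAlgebra ℂ SpinGen⦄, SpinRel ℂ a b →
      FreeAlgebra.lift ℂ g a = FreeAlgebra.lift ℂ g b := by
    rintro a b (_ | _ | _) <;>
      simp only [map_add, map_mul, map_ofNat, FreeAlgebra.lift_ι_apply, g] <;> assumption
  refine ⟨RingQuot.liftAlgHom ℂ ⟨FreeAlgebra.lift ℂ g, hg⟩, ⟨?_, ?_⟩, ?_⟩
  · simp [spinGen, g]
  · simp [spinGen, g]
  · rintro ρ ⟨h1, h2⟩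
    have h3 := spinAlgHom_apply_z ρ h1 h2 xy
    refine RingQuot.ringQuot_ext' _ _ _ (FreeAlgebra.hom_ext (funext fun s => ?_))
    simp only [Function.comp_apply, AlgHom.coe_comp,
      RingQuot.liftAlgHom_mkAlgHom_apply, FreeAlgebra.lift_ι_apply]
    cases s
    · exact h1
    · exact h2
    · exact h3

end SpinRepresentations

/-! ### Irreducible modules of the Terwilliger algebra as `sl₂`-strings. -/

section TerwilligerModules

variable {D : ℕ} {x : Fin D → Fin 2}

theorem isParityPair_cube (x : Fin D → Fin 2) :
    IsParityPair (Matrix.toLin' (cubeA D)) (heightOp x) (parityOp x) :=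
  toLin'_cubeA (D := D) ▸ isParityPair_flip x

theorem heightOp_apply (x : Fin D → Fin 2) (f : (Fin D → Fin 2) → ℂ) (y : Fin D → Fin 2) :
    heightOp x f y = ((D : ℂ) - 2 * hammingDist x y) * f y := by
  rw [heightOp, mulOp_apply, sum_coordSign_apply]

theorem dualIdempotent_mulVec (i : ℕ) (f : (Fin D → Fin 2) → ℂ) (y : Fin D → Fin 2) :
    (dualIdempotent (hypercube D) x i).mulVec f y = if hammingDist x y = i then f y else 0 := by
  have h := @Matrix.mulVec_diagonal _ ℂ _ _ (fun a b => Classical.propDecidable (a = b))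
    (fun z => if (hypercube D).dist x z = i then 1 else 0) f y
  rw [hypercube_dist, ite_mul, one_mul, zero_mul] at h
  rw [← h, dualIdempotent]

/-- Eigenvectors of the height operator are functions supported at one distance, so they can stand
in for the images of the dual idempotents. -/
theorem heightOp_eq_smul_iff {f : (Fin D → Fin 2) → ℂ} {c : ℂ} :
    heightOp x f = c • f ↔ ∀ y, f y ≠ 0 → (D : ℂ) - 2 * hammingDist x y = c := by
  rw [funext_iff]
  refine forall_congr' fun y => ?_
  rw [heightOp_apply, Pi.smul_apply, smul_eq_mul, mul_eq_mul_right_iff]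
  tauto

theorem hammingDist_eq_of_heightOp {f : (Fin D → Fin 2) → ℂ} {j : ℕ}
    (hf : heightOp x f = ((D : ℂ) - 2 * j) • f) {y : Fin D → Fin 2} (hy : f y ≠ 0) :
    hammingDist x y = j := by
  have h := heightOp_eq_smul_iff.1 hf y hy
  have h1 : (hammingDist x y : ℂ) = j := by linear_combination -(1 / 2 : ℂ) * h
  exact_mod_cast h1

theorem dualIdempotent_mulVec_of_heightOp {f : (Fin D → Fin 2) → ℂ} {j : ℕ}
    (hf : heightOp x f = ((D : ℂ) - 2 * j) • f) (i : ℕ) :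
    (dualIdempotent (hypercube D) x i).mulVec f = if i = j then f else 0 := by
  funext y
  rw [dualIdempotent_mulVec]
  by_cases hy : f y = 0
  · split_ifs <;> simp [hy]
  · rw [hammingDist_eq_of_heightOp hf hy]
    simp only [eq_comm (a := j)]
    split_ifs <;> rfl

theorem heightOp_dualIdempotent_mulVec (i : ℕ) (f : (Fin D → Fin 2) → ℂ) :
    heightOp x ((dualIdempotent (hypercube D) x i).mulVec f) =
      ((D : ℂ) - 2 * i) • (dualIdempotent (hypercube D) x i).mulVec f := by
  refine heightOp_eq_smul_iff.2 fun y hy => ?_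
  rw [dualIdempotent_mulVec] at hy
  rw [of_not_not fun h => hy (if_neg h)]

theorem parityOp_of_heightOp {f : (Fin D → Fin 2) → ℂ} {j : ℕ}
    (hf : heightOp x f = ((D : ℂ) - 2 * j) • f) : parityOp x f = ((-1) ^ j : ℂ) • f := by
  funext y
  rw [parityOp, mulOp_apply, prod_coordSign_apply, Pi.smul_apply, smul_eq_mul]
  by_cases hy : f y = 0
  · simp [hy]
  · rw [hammingDist_eq_of_heightOp hf hy]

theorem hammingDist_le (x y : Fin D → Fin 2) : hammingDist x y ≤ D := by
  simpa using hammingDist_le_card_fintype (x := x) (y := y)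

theorem eq_zero_of_heightOp_of_lt {f : (Fin D → Fin 2) → ℂ} {j : ℕ}
    (hf : heightOp x f = ((D : ℂ) - 2 * j) • f) (hj : D < j) : f = 0 := by
  funext y
  by_contra hy
  have h1 := hammingDist_eq_of_heightOp hf hy
  have h2 := hammingDist_le x y
  omega

theorem eq_zero_of_heightOp_eq_add_two {f : (Fin D → Fin 2) → ℂ}
    (hf : heightOp x f = ((D : ℂ) + 2) • f) : f = 0 := by
  funext y
  by_contra hy
  have h1 := heightOp_eq_smul_iff.1 hf y hy
  have h2 : ((hammingDist x y + 1 : ℕ) : ℂ) = 0 := by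
    push_cast
    linear_combination -(1 / 2 : ℂ) * h1
  exact absurd (Nat.cast_eq_zero.1 h2) (Nat.succ_ne_zero _)

theorem sum_dualIdempotent_mulVec (x : Fin D → Fin 2) (f : (Fin D → Fin 2) → ℂ) :
    ∑ i ∈ Finset.range (D + 1), (dualIdempotent (hypercube D) x i).mulVec f = f := by
  funext y
  rw [Finset.sum_apply]
  simp only [dualIdempotent_mulVec]
  rw [Finset.sum_ite_eq, if_pos (Finset.mem_range.2 (Nat.lt_succ_of_le (hammingDist_le x y)))]

theorem isModuleFor_terwilliger_iff {W : Submodule ℂ ((Fin D → Fin 2) → ℂ)} :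
    IsModuleFor (terwilliger (hypercube D) x) W ↔
      (∀ w ∈ W, Matrix.toLin' (cubeA D) w ∈ W) ∧
      ∀ i, ∀ w ∈ W, (dualIdempotent (hypercube D) x i).mulVec w ∈ W := by
  constructor
  · intro h
    refine ⟨fun w hw => h _ (Algebra.subset_adjoin (Or.inl (Algebra.subset_adjoin rfl))) w hw,
      fun i w hw => h _ (Algebra.subset_adjoin (Or.inr ?_)) w hw⟩
    exact Submodule.subset_span ⟨i, rfl⟩
  · rintro ⟨hA, hE⟩
    let S : Subalgebra ℂ (Matrix (Fin D → Fin 2) (Fin D → Fin 2) ℂ) :=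
      { carrier := {N | ∀ w ∈ W, N.mulVec w ∈ W}
        mul_mem' := fun {M N} hM hN w hw => by
          rw [← Matrix.mulVec_mulVec]; exact hM _ (hN _ hw)
        add_mem' := fun {M N} hM hN w hw => by
          rw [Matrix.add_mulVec]; exact W.add_mem (hM _ hw) (hN _ hw)
        algebraMap_mem' := fun c w hw => by
          rw [Algebra.algebraMap_eq_smul_one, Matrix.smul_mulVec, Matrix.one_mulVec]
          exact W.smul_mem _ hw }
    have hS : terwilliger (hypercube D) x ≤ S := by
      refine Algebra.adjoin_le (Set.union_subset ?_ ?_)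
      · exact Algebra.adjoin_le (Set.singleton_subset_iff.2 hA)
      · change dualBoseMesner (hypercube D) x ≤ Subalgebra.toSubmodule S
        refine Submodule.span_le.2 ?_
        rintro _ ⟨i, rfl⟩
        exact hE i
    exact fun N hN w hw => hS hN w hw

theorem heightOp_mem {W : Submodule ℂ ((Fin D → Fin 2) → ℂ)}
    (hE : ∀ i, ∀ w ∈ W, (dualIdempotent (hypercube D) x i).mulVec w ∈ W)
    {w : (Fin D → Fin 2) → ℂ} (hw : w ∈ W) : heightOp x w ∈ W := by
  rw [← sum_dualIdempotent_mulVec x w, map_sum]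
  refine W.sum_mem fun i _ => ?_
  rw [heightOp_dualIdempotent_mulVec]
  exact W.smul_mem _ (hE i w hw)

theorem parityOp_mem {W : Submodule ℂ ((Fin D → Fin 2) → ℂ)}
    (hE : ∀ i, ∀ w ∈ W, (dualIdempotent (hypercube D) x i).mulVec w ∈ W)
    {w : (Fin D → Fin 2) → ℂ} (hw : w ∈ W) : parityOp x w ∈ W := by
  rw [← sum_dualIdempotent_mulVec x w, map_sum]
  refine W.sum_mem fun i _ => ?_
  rw [parityOp_of_heightOp (heightOp_dualIdempotent_mulVec i w)]
  exact W.smul_mem _ (hE i w hw)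

theorem lowering_mem {V : Type*} [AddCommGroup V] [Module ℂ V] {A H : Module.End ℂ V}
    {W : Submodule ℂ V} (hA : ∀ w ∈ W, A w ∈ W) (hH : ∀ w ∈ W, H w ∈ W) {w : V} (hw : w ∈ W) :
    lowering A H w ∈ W :=
  W.smul_mem _ (W.add_mem (W.smul_mem _ (hA w hw)) (W.sub_mem (hH _ (hA w hw)) (hA _ (hH w hw))))

theorem raising_mem {V : Type*} [AddCommGroup V] [Module ℂ V] {A H : Module.End ℂ V}
    {W : Submodule ℂ V} (hA : ∀ w ∈ W, A w ∈ W) (hH : ∀ w ∈ W, H w ∈ W) {w : V} (hw : w ∈ W) :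
    raising A H w ∈ W :=
  W.smul_mem _ (W.sub_mem (W.smul_mem _ (hA w hw)) (W.sub_mem (hH _ (hA w hw)) (hA _ (hH w hw))))

/-- A nonzero module for the Terwilliger algebra contains a vector that lives at a single distance
from `x` and is killed by the lowering operator. -/
theorem exists_lowest_weight_vector {W : Submodule ℂ ((Fin D → Fin 2) → ℂ)}
    (hW : IsModuleFor (terwilliger (hypercube D) x) W) (hW0 : W ≠ ⊥) :
    ∃ r : ℕ, ∃ w ∈ W, w ≠ 0 ∧ heightOp x w = ((D : ℂ) - 2 * r) • w ∧
      lowering (Matrix.toLin' (cubeA D)) (heightOp x) w = 0 := by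
  classical
  obtain ⟨hA, hE⟩ := isModuleFor_terwilliger_iff.1 hW
  have hex : ∃ r : ℕ, ∃ w ∈ W, w ≠ 0 ∧ heightOp x w = ((D : ℂ) - 2 * r) • w := by
    obtain ⟨f, hf, hf0⟩ := W.exists_mem_ne_zero_of_ne_bot hW0
    rw [← sum_dualIdempotent_mulVec x f] at hf0
    obtain ⟨i, -, hi⟩ := Finset.exists_ne_zero_of_sum_ne_zero hf0
    exact ⟨i, _, hE i f hf, hi, heightOp_dualIdempotent_mulVec i f⟩
  -- At the least distance `r` occurring in `W`, a nonzero image under lowering would live at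
  -- distance `r - 1`: impossible by minimality, or for `r = 0` because the height never exceeds
  -- `D`.
  obtain ⟨w, hw, hw0, hwH⟩ := Nat.find_spec hex
  refine ⟨Nat.find hex, w, hw, hw0, hwH, ?_⟩
  have h1 := congrArg (fun f => f w) (isParityPair_cube x).snd_mul_lowering
  simp only [Module.End.mul_apply, LinearMap.add_apply, LinearMap.smul_apply, hwH, map_smul,
    ← add_smul] at h1
  by_contra h0
  rcases hr : Nat.find hex with _ | r
  · rw [hr] at h1
    exact h0 (eq_zero_of_heightOp_eq_add_two (x := x) (by simpa using h1))
  · refine Nat.find_min hex (m := r) (by omega)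
      ⟨_, lowering_mem hA (fun w hw => heightOp_mem hE hw) hw, h0, ?_⟩
    rw [h1, hr]
    congr 1
    push_cast
    ring

/-- An irreducible module for the Terwilliger algebra of the hypercube is spanned by a chain
`u 0, …, u d`, on which it is given explicitly; `r` is its endpoint and `d` its diameter. -/
structure IsCubeChain (x : Fin D → Fin 2) (W : Submodule ℂ ((Fin D → Fin 2) → ℂ)) (r d : ℕ)
    (u : ℕ → (Fin D → Fin 2) → ℂ) : Prop where
  diam : D = 2 * r + d
  mem : ∀ k, u k ∈ W
  ne_zero : ∀ k ≤ d, u k ≠ 0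
  eq_zero : u (d + 1) = 0
  raising : ∀ k, raising (Matrix.toLin' (cubeA D)) (heightOp x) (u k) = u (k + 1)
  lowering : ∀ k, lowering (Matrix.toLin' (cubeA D)) (heightOp x) (u k) =
    (k * (d - k + 1) : ℂ) • u (k - 1)
  height : ∀ k, heightOp x (u k) = ((D : ℂ) - 2 * (r + k : ℕ)) • u k
  span_eq : Submodule.span ℂ (Set.range fun i : Fin (d + 1) => u i) = W

/-- Raising a lowest vector repeatedly must stop, as distances are at most `D`. The span of the
string is stable under `A = L + R` and under the dual idempotents, so irreducibility makes it all of
`W`. -/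
theorem exists_isCubeChain {W : Submodule ℂ ((Fin D → Fin 2) → ℂ)}
    (hW : IsIrreducibleModuleFor (terwilliger (hypercube D) x) W) :
    ∃ r d u, IsCubeChain x W r d u := by
  classical
  obtain ⟨hWT, hW0, hirr⟩ := hW
  obtain ⟨hA, hE⟩ := isModuleFor_terwilliger_iff.1 hWT
  have hH : ∀ w ∈ W, heightOp x w ∈ W := fun w hw => heightOp_mem hE hw
  obtain ⟨r, w, hw, hw0, hwH, hwL⟩ := exists_lowest_weight_vector hWT hW0
  set R := raising (Matrix.toLin' (cubeA D)) (heightOp x) with hR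
  set u : ℕ → (Fin D → Fin 2) → ℂ := fun k => (R ^ k) w with hu
  have hchain := (isParityPair_cube x).lowering_raising_pow_apply hwH hwL
  have hRu : ∀ k, R (u k) = u (k + 1) := fun k => by
    simp only [hu]
    rw [pow_succ', Module.End.mul_apply]
  have hmem : ∀ k, u k ∈ W := by
    intro k
    induction k with
    | zero => simpa [hu] using hw
    | succ k ih => rw [← hRu]; exact raising_mem hA hH ih
  have hheight : ∀ k, heightOp x (u k) = ((D : ℂ) - 2 * (r + k : ℕ)) • u k := fun k => by
    rw [(hchain k).1]
    congr 1
    push_cast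
    ring
  have hex : ∃ m, u m = 0 := ⟨D + 1, eq_zero_of_heightOp_of_lt (hheight _) (by omega)⟩
  obtain ⟨d, hd⟩ : ∃ d, Nat.find hex = d + 1 := by
    refine Nat.exists_eq_succ_of_ne_zero fun h => hw0 ?_
    simpa [h, hu] using Nat.find_spec hex
  have hzero : u (d + 1) = 0 := hd ▸ Nat.find_spec hex
  have hne : ∀ k ≤ d, u k ≠ 0 := fun k hk => Nat.find_min hex (by omega)
  have hdiam : D = 2 * r + d := by
    -- Lowering the vanishing vector `u (d + 1)` gives `(d + 1)(D - 2r - d) u d = 0`, which fixes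
    -- the length of the string.
    have h1 := (hchain (d + 1)).2
    change lowering _ _ (u (d + 1)) = _ • u d at h1
    rw [hzero, map_zero, eq_comm, smul_eq_zero] at h1
    have h2 := h1.resolve_right (hne d le_rfl)
    have h3 : ((d + 1 : ℕ) : ℂ) ≠ 0 := by exact_mod_cast d.succ_ne_zero
    have h4 := (mul_eq_zero.1 h2).resolve_left h3
    push_cast at h4
    have h5 : (D : ℂ) = 2 * r + d := by linear_combination h4
    exact_mod_cast h5
  have hlow : ∀ k, lowering (Matrix.toLin' (cubeA D)) (heightOp x) (u k) =
      (k * (d - k + 1) : ℂ) • u (k - 1) := fun k => by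
    rw [(hchain k).2]
    congr 2
    rw [hdiam]
    push_cast
    ring
  refine ⟨r, d, u, hdiam, hmem, hne, hzero, hRu, hlow, hheight, ?_⟩
  set U := Submodule.span ℂ (Set.range fun i : Fin (d + 1) => u i)
  have huU : ∀ k ≤ d + 1, u k ∈ U := by
    intro k hk
    rcases hk.eq_or_lt with rfl | hk
    · rw [hzero]; exact U.zero_mem
    · exact Submodule.subset_span ⟨⟨k, hk⟩, rfl⟩
  have hU : IsModuleFor (terwilliger (hypercube D) x) U := by
    rw [isModuleFor_terwilliger_iff]
    constructor
    · change U ≤ U.comap (Matrix.toLin' (cubeA D))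
      refine Submodule.span_le.2 ?_
      rintro _ ⟨i, rfl⟩
      change Matrix.toLin' (cubeA D) (u i) ∈ U
      rw [← lowering_add_raising (Matrix.toLin' (cubeA D)) (heightOp x), LinearMap.add_apply, hlow,
        ← hR, hRu]
      exact U.add_mem (U.smul_mem _ (huU _ (by omega))) (huU _ (by omega))
    · intro j
      change U ≤ U.comap (dualIdempotent (hypercube D) x j).mulVecLin
      refine Submodule.span_le.2 ?_
      rintro _ ⟨i, rfl⟩
      change (dualIdempotent (hypercube D) x j).mulVec (u i) ∈ U
      rw [dualIdempotent_mulVec_of_heightOp (hheight i)]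
      split_ifs
      · exact huU _ (by omega)
      · exact U.zero_mem
  refine (hirr U hU (Submodule.span_le.2 ?_)).resolve_left ?_
  · rintro _ ⟨i, rfl⟩
    exact hmem i
  · intro h
    exact hne 0 (Nat.zero_le d) ((Submodule.eq_bot_iff U).1 h _ (huU 0 (by omega)))

namespace IsCubeChain

variable {W : Submodule ℂ ((Fin D → Fin 2) → ℂ)} {r d : ℕ} {u : ℕ → (Fin D → Fin 2) → ℂ}

theorem finrank_le (h : IsCubeChain x W r d u) : Module.finrank ℂ W ≤ d + 1 := by
  rw [← h.span_eq]
  exact (finrank_range_le_card (R := ℂ) fun i : Fin (d + 1) => u i).trans_eq (Fintype.card_fin _)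

theorem parity (h : IsCubeChain x W r d u) (k : ℕ) :
    parityOp x (u k) = ((-1) ^ (r + k) : ℂ) • u k :=
  parityOp_of_heightOp (h.height k)

/-- On `u k` the value is `(d - 2k)² + 2((k + 1)(d - k) + k(d - k + 1))`, independent of `k`. -/
theorem casimir_apply (h : IsCubeChain x W r d u) {w : (Fin D → Fin 2) → ℂ} (hw : w ∈ W) :
    (heightOp x * heightOp x + (2 : ℂ) •
      (BannaiIto.lowering (Matrix.toLin' (cubeA D)) (heightOp x) *
        BannaiIto.raising (Matrix.toLin' (cubeA D)) (heightOp x) +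
      BannaiIto.raising (Matrix.toLin' (cubeA D)) (heightOp x) *
        BannaiIto.lowering (Matrix.toLin' (cubeA D)) (heightOp x))) w =
      ((d : ℂ) * (d + 2)) • w := by
  rw [← h.span_eq] at hw
  induction hw using Submodule.span_induction with
  | zero => simp
  | add a b _ _ ha hb => rw [map_add, ha, hb, smul_add]
  | smul c a _ ha => rw [map_smul, ha, smul_comm]
  | mem a ha =>
    obtain ⟨i, rfl⟩ := ha
    have hD : (D : ℂ) = 2 * r + d := by exact_mod_cast h.diam
    simp only [LinearMap.add_apply, LinearMap.smul_apply, Module.End.mul_apply, h.height, h.lowering,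
      h.raising, map_smul, hD]
    generalize (i : ℕ) = k
    rcases k with _ | k
    · simp only [zero_add]
      push_cast
      module
    · simp only [Nat.add_sub_cancel]
      push_cast
      module

/-- Projection to distance `r` leaves only `u 0`. -/
theorem sum_ne_zero (h : IsCubeChain x W r d u) {c : ℕ → ℂ} (hc : c 0 = 1) :
    ∑ k ∈ Finset.range (d + 1), c k • u k ≠ 0 := by
  intro h0
  have h1 := congrArg (dualIdempotent (hypercube D) x r).mulVecLin h0
  rw [map_zero, map_sum, Finset.sum_eq_single 0] at h1
  · rw [map_smul, Matrix.mulVecLin_apply, dualIdempotent_mulVec_of_heightOp (h.height 0),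
      if_pos (add_zero r).symm, hc, one_smul] at h1
    exact h.ne_zero 0 (Nat.zero_le d) h1
  · intro k _ hk
    rw [map_smul, Matrix.mulVecLin_apply, dualIdempotent_mulVec_of_heightOp (h.height k),
      if_neg (by omega), smul_zero]
  · simp

theorem exists_eigenvector {M : Module.End ℂ ((Fin D → Fin 2) → ℂ)} (h : IsCubeChain x W r d u)
    {s : ℕ → ℂ} (hs : ∀ k, s k * s k = 1)
    (hM : ∀ k, M (u k) = s k • u (k + 1) + (s (k - 1) * (k * (d - k + 1))) • u (k - 1)) :
    ∃ v ∈ W, v ≠ 0 ∧ M v = (d : ℂ) • v :=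
  ⟨_, W.sum_mem fun k _ => W.smul_mem _ (h.mem k), h.sum_ne_zero (by simp [signProd]),
    apply_sum_signProd hs hM h.eq_zero⟩

theorem exists_eigenvector_fst (h : IsCubeChain x W r d u) :
    ∃ v ∈ W, v ≠ 0 ∧ Matrix.toLin' (cubeA D) v = (d : ℂ) • v := by
  refine h.exists_eigenvector (s := fun _ => 1) (fun _ => one_mul 1) fun k => ?_
  nth_rw 1 [← lowering_add_raising (Matrix.toLin' (cubeA D)) (heightOp x)]
  rw [LinearMap.add_apply, h.lowering, h.raising]
  module

/-- On `u k` the eigenvalue is `(-1)^(r + k) (d - 2k)`; it equals `d` at `k = 0` for even `r` and at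
`k = d` for odd `r`. -/
theorem exists_eigenvector_snd (h : IsCubeChain x W r d u) (hd : Even d) :
    ∃ v ∈ W, v ≠ 0 ∧ (parityOp x * heightOp x) v = (d : ℂ) • v := by
  have hD : (D : ℂ) = 2 * r + d := by exact_mod_cast h.diam
  rcases Nat.even_or_odd r with hr | hr
  · refine ⟨u 0, h.mem 0, h.ne_zero 0 (Nat.zero_le d), ?_⟩
    rw [Module.End.mul_apply, h.height, map_smul, h.parity, add_zero, hr.neg_one_pow, hD]
    module
  · refine ⟨u d, h.mem d, h.ne_zero d le_rfl, ?_⟩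
    rw [Module.End.mul_apply, h.height, map_smul, h.parity, (hr.add_even hd).neg_one_pow, hD]
    push_cast
    module

theorem exists_eigenvector_trd (h : IsCubeChain x W r d u) :
    ∃ v ∈ W, v ≠ 0 ∧ (parityOp x * (BannaiIto.lowering (Matrix.toLin' (cubeA D)) (heightOp x) -
      BannaiIto.raising (Matrix.toLin' (cubeA D)) (heightOp x))) v = (d : ℂ) • v := by
  -- The parity at `u (k + 1)` times the minus sign of `-R` is `(-1)^(r + k)`, and the lowering term
  -- carries the parity of `u (k - 1)`.
  refine h.exists_eigenvector (s := fun k => (-1) ^ (r + k))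
    (fun k => by rw [← mul_pow]; simp) fun k => ?_
  rw [Module.End.mul_apply, LinearMap.sub_apply, h.lowering, h.raising, map_sub, map_smul,
    h.parity, h.parity, ← add_assoc, pow_succ]
  module

end IsCubeChain

theorem isSpinTriple_restrict {V : Type*} [AddCommGroup V] [Module ℂ V] {X Y Z : Module.End ℂ V}
    {d : ℕ} {W : Submodule ℂ V} (xy : X * Y + Y * X = 2 * Z) (yz : Y * Z + Z * Y = 2 * X)
    (zx : Z * X + X * Z = 2 * Y)
    (hΩ : ∀ w ∈ W, (X * X + Y * Y + Z * Z) w = ((d : ℂ) * (d + 2)) • w)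
    (hX : ∀ w ∈ W, X w ∈ W) (hY : ∀ w ∈ W, Y w ∈ W) (hZ : ∀ w ∈ W, Z w ∈ W) :
    IsSpinTriple d (X.restrict hX) (Y.restrict hY) (Z.restrict hZ) where
  xy := LinearMap.ext fun w => Subtype.ext <| by
    rw [two_mul] at xy ⊢; exact congrArg (fun f => f (w : V)) xy
  yz := LinearMap.ext fun w => Subtype.ext <| by
    rw [two_mul] at yz ⊢; exact congrArg (fun f => f (w : V)) yz
  zx := LinearMap.ext fun w => Subtype.ext <| by
    rw [two_mul] at zx ⊢; exact congrArg (fun f => f (w : V)) zx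
  casimir := LinearMap.ext fun w => Subtype.ext (hΩ w w.2)

end TerwilligerModules

end BannaiIto

/-! ### The module structure and its restriction to irreducible modules. -/

open BannaiIto in
theorem mainTheorem4 (D : ℕ) (hD : Even D) (x : Fin D → Fin 2) :
    (∃! ρ : BannaiIto.SpinAlgebra ℂ →ₐ[ℂ] Module.End ℂ ((Fin D → Fin 2) → ℂ),
      BannaiIto.IsCubeStructure D x ρ) ∧
    ∀ ρ : BannaiIto.SpinAlgebra ℂ →ₐ[ℂ] Module.End ℂ ((Fin D → Fin 2) → ℂ),
      BannaiIto.IsCubeStructure D x ρ →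
      ∀ C : Matrix (Fin D → Fin 2) (Fin D → Fin 2) ℂ,
        C = LinearMap.toMatrix' (ρ (BannaiIto.spinGen ℂ BannaiIto.SpinGen.z)) →
        ∀ W : Submodule ℂ ((Fin D → Fin 2) → ℂ),
          BannaiIto.IsIrreducibleModuleFor
            (BannaiIto.terwilliger (BannaiIto.hypercube D) x) W →
          ∃ (hA : ∀ w ∈ W, (BannaiIto.cubeA D).mulVecLin w ∈ W)
            (hB : ∀ w ∈ W, (BannaiIto.cubeB D x).mulVecLin w ∈ W)
            (hC : ∀ w ∈ W, C.mulVecLin w ∈ W),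
            BannaiIto.IsTotallyBipartiteLeonardTriple
              (BannaiIto.actionOn (BannaiIto.cubeA D) W hA)
              (BannaiIto.actionOn (BannaiIto.cubeB D x) W hB)
              (BannaiIto.actionOn C W hC) ∧
            BannaiIto.IsBannaiItoType
              (BannaiIto.actionOn (BannaiIto.cubeA D) W hA)
              (BannaiIto.actionOn (BannaiIto.cubeB D x) W hB)
              (BannaiIto.actionOn C W hC) := by
  have hpair := isParityPair_cube x
  have hBop := toLin'_cubeB hD x
  have xy := hpair.xy
  have yz := hpair.yz
  have zx := hpair.zx
  have hΩ := hpair.casimir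
  rw [← hBop] at xy yz zx hΩ
  refine ⟨existsUnique_spinAlgHom xy yz zx, ?_⟩
  rintro ρ ⟨hρx, hρy⟩ C hCρ W hW
  have hCop : Matrix.toLin' C = parityOp x *
      (lowering (Matrix.toLin' (cubeA D)) (heightOp x) -
        raising (Matrix.toLin' (cubeA D)) (heightOp x)) := by
    rw [hCρ, Matrix.toLin'_toMatrix', spinAlgHom_apply_z ρ hρx hρy xy]
  obtain ⟨r, d, u, hu⟩ := exists_isCubeChain hW
  -- `D = 2r + d`, so the evenness required of spin triples is inherited from the cube.
  have hd : Even d := by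
    have h := hu.diam
    obtain ⟨m, rfl⟩ := hD
    exact ⟨m - r, by omega⟩
  obtain ⟨hA, hE⟩ := isModuleFor_terwilliger_iff.1 hW.1
  have hH : ∀ w ∈ W, heightOp x w ∈ W := fun w hw => heightOp_mem hE hw
  have hB : ∀ w ∈ W, Matrix.toLin' (cubeB D x) w ∈ W := fun w hw => by
    rw [hBop]
    exact parityOp_mem hE (hH w hw)
  have hC : ∀ w ∈ W, Matrix.toLin' C w ∈ W := fun w hw => by
    rw [hCop]
    exact parityOp_mem hE (W.sub_mem (lowering_mem hA hH hw) (raising_mem hA hH hw))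
  obtain ⟨a, ha, ha0, haA⟩ := hu.exists_eigenvector_fst
  obtain ⟨b, hb, hb0, hbB⟩ := hu.exists_eigenvector_snd hd
  obtain ⟨c, hc, hc0, hcC⟩ := hu.exists_eigenvector_trd
  rw [← hBop] at hbB
  rw [← hCop] at hcC xy yz zx hΩ
  have hspin := isSpinTriple_restrict (d := d) (W := W) xy yz zx
    (fun w hw => by rw [hΩ]; exact hu.casimir_apply hw) hA hB hC
  refine ⟨hA, hB, hC, hspin.isTotallyBipartiteLeonardTriple hd hu.finrank_le ?_ ?_ ?_⟩
  · exact ⟨⟨a, ha⟩, fun h => ha0 (congrArg Subtype.val h), Subtype.ext haA⟩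
  · exact ⟨⟨b, hb⟩, fun h => hb0 (congrArg Subtype.val h), Subtype.ext hbB⟩
  · exact ⟨⟨c, hc⟩, fun h => hc0 (congrArg Subtype.val h), Subtype.ext hcC⟩
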